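/- Let $X$ be a connected Riemann surface (for instance a compact one of genus $g\ge 2$) with holomorphic tangent bundle $TX$ and holomorphic cotangent bundle $K=K_X$, and let $n,m\ge 2$ be integers. All subbundles below are holomorphic. Let $E$ be a holomorphic vector bundle of rank $2n$ on $X$ with $\bigwedge^{2n}E\cong\mathcal O_X$, let $B_0$ be a fibrewise nondegenerate holomorphic symmetric bilinear form on $E$, and let $$0=F_0\subset F_1\subset\cdots\subset F_{2m}\subset F_{2m+1}=E$$ be a filtration by subbundles such that $\operatorname{rank}(F_{m+1}/F_m)=2\operatorname{rank}F_1$, $\operatorname{rank}(F_i/F_{i-1})=\operatorname{rank}F_1$ for all $i\in\{1,\dots,2m+1\}\setminus\{m+1\}$, and $F_i^{\perp}=F_{2m+1-i}$ for $0\le i\le m$, where $\perp$ is taken with respect to $B_0$. Let $D:E\to E\otimes K$ be a holomorphic connection with $dB_0(s,t)=B_0(Ds,t)+B_0(s,Dt)$ such that 1. $D(F_i)\subset F_{i+1}\otimes K$ for $1\le i\le 2m$; 2. the second fundamental form $S(D,i):F_i/F_{i-1}\to (F_{i+1}/F_i)\otimes K$, $[s]\mapsto [Ds]$, is an isomorphism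 for all $i\in\{1,\dots,2m\}\setminus\{m,m+1\}$; 3. the composition $(S(D,m+1)\otimes \mathrm{Id}_K)\circ S(D,m):F_m/F_{m-1}\to (F_{m+2}/F_{m+1})\otimes K^{\otimes 2}$ is an isomorphism. (That is, $(E,B_0,F_\bullet,D)$ is a generalized $\mathrm{SO}(2n,\mathbb C)$-quasioper.) For a holomorphic vector bundle $W$ with a holomorphic connection $D_W$ and a subbundle $V\subset W$, let $\widehat D_W(V)$ be the smallest subbundle $U\subset W$ containing $V$ with $D_W(V)\subset U\otimes K$, and let $\widehat D_W^{\,k}$ denote the $k$-fold iterate of $\widehat D_W$. Put $$\mathbb F=\widehat D_E^{\,2m}(F_1)\subset E .$$ Let $D^*$ be the dual connection on $E^*$, let $G_1=\ker\big(E^*\to (F_{2m})^*\big)$ and $\mathbb G=\widehat{D^*}_{E^*}^{\,2m}(G_1)\subset E^*$, and let $$\mathcal S=(E^*/\mathbb G)^*\subset E^{**}=E,$$ i.e. $\mathcal S_x$ is the common zero space in $E_x$ of the functionals in $\mathbb G_x$. Let $Q=E/F_{2m}$ with quotient map $q:E\to Q$, and let $J^{2m}(Q)$ be its jet bundle of order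 $2m$. Then $D$ induces a homomorphism of holomorphic vector bundles $$f_{2m}:E\to J^{2m}(Q),$$ which sends $v\in E_x$ to the $2m$-jet at $x$ of $q(\widetilde v)$, where $\widetilde v$ is the flat section of $(E,D)$ near $x$ with $\widetilde v(x)=v$. Moreover $\mathbb F$ and $\mathcal S$ are holomorphic subbundles of $E$, the composition $$\mathbb F\hookrightarrow E\xrightarrow{\ f_{2m}\ }J^{2m}(Q)$$ is an isomorphism of holomorphic vector bundles, and $\ker(f_{2m})=\mathcal S$. -/

import Mathlib

open Bundle Filter
open scoped Manifold ContDiff Topology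

noncomputable section

namespace Quasioper

/-! ## Families of vector spaces and their germs of holomorphic sections -/

section Families

variable {X : Type*} [TopologicalSpace X] [ChartedSpace ℂ X]

/-- `g` is holomorphic (complex analytic) in a neighbourhood of `x`. -/
abbrev HolAt (g : X → ℂ) (x : X) : Prop :=
  ContMDiffAt 𝓘(ℂ, ℂ) 𝓘(ℂ, ℂ) ω g x

/-- A holomorphic structure on a family of vector spaces `V x`, `x ∈ X`, given by its germs of
holomorphic sections: for every `x` the space of those sections which are holomorphic near `x`.
A local section is represented by an arbitrary extension to all of `X`. -/
abbrev HolGerms (V : X → Type*) [∀ x, AddCommGroup (V x)] [∀ x, Module ℂ (V x)] :=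
  ∀ _ : X, Submodule ℂ (Π y, V y)

variable {V W : X → Type*} [∀ x, AddCommGroup (V x)] [∀ x, Module ℂ (V x)]
  [∀ x, AddCommGroup (W x)] [∀ x, Module ℂ (W x)]

/-- A fibrewise linear map is a homomorphism of holomorphic bundles if it takes
holomorphic sections to holomorphic sections. -/
def IsHolHom (Γ : HolGerms V) (Γ' : HolGerms W) (f : ∀ x, V x →ₗ[ℂ] W x) : Prop :=
  ∀ x, ∀ σ ∈ Γ x, (fun y => f y (σ y)) ∈ Γ' x

/-- An isomorphism of holomorphic bundles: fibrewise bijective, and holomorphic sections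
correspond to holomorphic sections in both directions. -/
def IsHolIso (Γ : HolGerms V) (Γ' : HolGerms W) (f : ∀ x, V x →ₗ[ℂ] W x) : Prop :=
  (∀ x, Function.Bijective (f x)) ∧ ∀ x, ∀ σ : Π y, V y, σ ∈ Γ x ↔ (fun y => f y (σ y)) ∈ Γ' x

/-! ### Jets -/

/-- The subspace `𝔪_x ^ (k + 1) · Γ_x` of `Γ_x`: the sections vanishing at `x` to order at least
`k + 1`. -/
def vanishing (Γ : HolGerms V) (k : ℕ) (x : X) : Submodule ℂ (Γ x) :=
  Submodule.span ℂ {σ | ∃ (h : Fin (k + 1) → X → ℂ) (τ : Γ x),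
    (∀ i, HolAt (h i) x ∧ h i x = 0) ∧ (σ : Π y, V y) = fun y => (∏ i, h i y) • τ.1 y}

/-- The fibre at `x` of the jet bundle of order `k`: `Γ_x / 𝔪_x ^ (k + 1) · Γ_x`, the restrictions
of holomorphic sections to the infinitesimal neighbourhood of order `k` of `x`. -/
abbrev JetFiber (Γ : HolGerms V) (k : ℕ) (x : X) : Type _ :=
  Γ x ⧸ vanishing Γ k x

open Classical in
/-- The `k`-jet at `x` of a section which is holomorphic near `x` (and `0` for other sections). -/
def jetAt (Γ : HolGerms V) (k : ℕ) (x : X) (σ : Π y, V y) : JetFiber Γ k x :=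
  if h : σ ∈ Γ x then (vanishing Γ k x).mkQ ⟨σ, h⟩ else 0

/-- The holomorphic structure of the jet bundle: its sheaf of holomorphic sections is generated,
over the holomorphic functions, by the prolongations `y ↦ jetAt Γ k y τ` of holomorphic sections. -/
def jetGerms (Γ : HolGerms V) (k : ℕ) : HolGerms (JetFiber Γ k) := fun x =>
  Submodule.span ℂ {σ | ∃ (g : X → ℂ) (τ : Π y, V y), HolAt g x ∧ τ ∈ Γ x ∧
    ∀ᶠ y in 𝓝 x, σ y = g y • jetAt Γ k y τ}

end Families

/-! ## Holomorphic vector bundles, subbundles, quotients -/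

section Bundles

variable {X : Type*} [TopologicalSpace X] [ChartedSpace ℂ X]
  (F : Type*) [NormedAddCommGroup F] [NormedSpace ℂ F]
  {E : X → Type*} [TopologicalSpace (TotalSpace F E)]
  [∀ x, AddCommGroup (E x)] [∀ x, Module ℂ (E x)] [∀ x, TopologicalSpace (E x)]
  [FiberBundle F E] [VectorBundle ℂ F E]

/-- The sections of a holomorphic vector bundle which are holomorphic near `x`. -/
def holGerms : HolGerms E := fun x =>
  { carrier := {s | ContMDiffAt 𝓘(ℂ, ℂ) (𝓘(ℂ, ℂ).prod 𝓘(ℂ, F)) ω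
      (fun y => TotalSpace.mk' F y (s y)) x}
    add_mem' := fun hs ht => hs.add_section ht
    zero_mem' := contMDiff_zeroSection ℂ E x
    smul_mem' := fun _ _ hs => hs.const_smul_section }

/-- `V` is a holomorphic subbundle: near every point it has a frame consisting of holomorphic
sections of the ambient bundle. -/
def IsHolSubbundle (V : ∀ x, Submodule ℂ (E x)) : Prop :=
  ∀ x, ∃ (k : ℕ) (s : Fin k → Π y, E y), (∀ i, s i ∈ holGerms F x) ∧
    ∀ᶠ y in 𝓝 x, LinearIndependent ℂ (fun i => s i y) ∧
      Submodule.span ℂ (Set.range fun i => s i y) = V y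

/-- The holomorphic structure of a subbundle. -/
def subGerms (V : ∀ x, Submodule ℂ (E x)) : HolGerms (fun x => V x) := fun x =>
  { carrier := {σ | (fun y => (σ y : E y)) ∈ holGerms F x}
    add_mem' := fun hs ht => (holGerms F x).add_mem hs ht
    zero_mem' := (holGerms F x).zero_mem
    smul_mem' := fun c _ hs => (holGerms F x).smul_mem c hs }

/-- The holomorphic structure of the quotient by a subbundle: a section is holomorphic if it
locally lifts to a holomorphic section. -/
def quotGerms (V : ∀ x, Submodule ℂ (E x)) : HolGerms (fun x => E x ⧸ V x) := fun x =>
  { carrier := {σ | ∃ s ∈ holGerms F x, ∀ᶠ y in 𝓝 x, σ y = (V y).mkQ (s y)}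
    add_mem' := by
      rintro σ τ ⟨s, hs, hs'⟩ ⟨t, ht, ht'⟩
      refine ⟨s + t, (holGerms F x).add_mem hs ht, ?_⟩
      filter_upwards [hs', ht'] with y h h'
      simp only [Pi.add_apply, h, h', map_add]
    zero_mem' := ⟨0, (holGerms F x).zero_mem, .of_forall fun y => by simp⟩
    smul_mem' := by
      rintro c σ ⟨s, hs, hs'⟩
      refine ⟨c • s, (holGerms F x).smul_mem c hs, ?_⟩
      filter_upwards [hs'] with y h
      simp only [Pi.smul_apply, h, map_smul] }

/-- The fibre at `x` of the quotient `V₂ / V₁` for subbundles `V₁ ⊆ V₂`. -/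
abbrev Gr (V₁ V₂ : ∀ x, Submodule ℂ (E x)) (x : X) : Type _ :=
  V₂ x ⧸ (V₁ x).submoduleOf (V₂ x)

variable {F}

variable (E) in
/-- The fibres of the dual bundle `E^*`. -/
abbrev Dual (x : X) : Type _ := E x →L[ℂ] Trivial X ℂ x

theorem mdifferentiableAt_pairing {φ : Π y, Dual E y} {s : Π y, E y} {x : X}
    (hφ : MDifferentiableAt 𝓘(ℂ, ℂ) (𝓘(ℂ, ℂ).prod 𝓘(ℂ, F →L[ℂ] ℂ))
      (fun y => TotalSpace.mk' (F →L[ℂ] ℂ) y (φ y)) x)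
    (hs : MDifferentiableAt 𝓘(ℂ, ℂ) (𝓘(ℂ, ℂ).prod 𝓘(ℂ, F))
      (fun y => TotalSpace.mk' F y (s y)) x) :
    MDifferentiableAt 𝓘(ℂ, ℂ) 𝓘(ℂ, ℂ) (fun y => (φ y (s y) : ℂ)) x := by
  have := MDifferentiableAt.clm_bundle_apply (F₁ := F) (F₂ := ℂ) (E₂ := Trivial X ℂ) hφ hs
  exact ((mdifferentiableAt_totalSpace 𝓘(ℂ, ℂ) _).1 this).2

end Bundles

/-! ## Holomorphic connections

A holomorphic connection is given by a covariant derivative `D` in the sense of Mathlib over the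
field `ℂ`, where `D s x v` is the derivative at `x` of the section `s` in the direction `v`, so that
`E ⊗ K` is the bundle with fibres `Hom (T_x X, E_x)`. -/

section Connections

variable {X : Type*} [TopologicalSpace X] [ChartedSpace ℂ X] [IsManifold 𝓘(ℂ, ℂ) ω X]
  {F : Type*} [NormedAddCommGroup F] [NormedSpace ℂ F]
  {E : X → Type*} [TopologicalSpace (TotalSpace F E)]
  [∀ x, AddCommGroup (E x)] [∀ x, Module ℂ (E x)] [∀ x, TopologicalSpace (E x)]
  [∀ x, IsTopologicalAddGroup (E x)] [∀ x, ContinuousSMul ℂ (E x)]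
  [FiberBundle F E] [VectorBundle ℂ F E]

/-- `D` takes holomorphic local sections of `E` to holomorphic local sections of `E ⊗ K`. -/
def IsHolConnection (D : CovariantDerivative 𝓘(ℂ, ℂ) F E) : Prop :=
  ∀ x, ∀ s ∈ holGerms F x,
    D s ∈ holGerms (ℂ →L[ℂ] F) (E := fun y => TangentSpace 𝓘(ℂ, ℂ) y →L[ℂ] E y) x

/-- `D(V) ⊆ U ⊗ K`. -/
def MapsInto (D : CovariantDerivative 𝓘(ℂ, ℂ) F E) (V U : ∀ x, Submodule ℂ (E x)) : Prop :=
  ∀ x, ∀ s ∈ holGerms F x, (∀ᶠ y in 𝓝 x, s y ∈ V y) →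
    ∀ v : TangentSpace 𝓘(ℂ, ℂ) x, D s x v ∈ U x

/-- `S : V₂/V₁ → (V₄/V₃) ⊗ K` is the second fundamental form of `(V₁, V₂, V₃, V₄)`: the value at
`x` on the class of a local holomorphic section `s` of `V₂` is the class of `D s` at `x`. -/
def IsSecondFundamentalForm (D : CovariantDerivative 𝓘(ℂ, ℂ) F E)
    (V₁ V₂ V₃ V₄ : ∀ x, Submodule ℂ (E x))
    (S : ∀ x, Gr V₁ V₂ x →ₗ[ℂ] TangentSpace 𝓘(ℂ, ℂ) x →ₗ[ℂ] Gr V₃ V₄ x) : Prop :=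
  ∀ x, ∀ s ∈ holGerms F x, ∀ hs : (∀ᶠ y in 𝓝 x, s y ∈ V₂ y), ∀ v : TangentSpace 𝓘(ℂ, ℂ) x,
    ∃ h : D s x v ∈ V₄ x,
      S x (Submodule.Quotient.mk ⟨s x, hs.self_of_nhds⟩) v = Submodule.Quotient.mk ⟨D s x v, h⟩

/-- The minimal holomorphic subbundle `U` containing `V` such that `D(V) ⊆ U ⊗ K`. It is defined
for all families `V`, as the fibrewise intersection of all such `U`; this is the least such `U`
as soon as there is a least one. -/
def Dhat (D : CovariantDerivative 𝓘(ℂ, ℂ) F E) (V : ∀ x, Submodule ℂ (E x)) :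
    ∀ x, Submodule ℂ (E x) :=
  sInf {U | IsHolSubbundle F U ∧ V ≤ U ∧ MapsInto D V U}

/-- `s` is holomorphic and flat near `x`, with `s x = v`. -/
def IsFlatThrough (D : CovariantDerivative 𝓘(ℂ, ℂ) F E) (x : X) (v : E x) (s : Π y, E y) : Prop :=
  s ∈ holGerms F x ∧ (∀ᶠ y in 𝓝 x, D s y = 0) ∧ s x = v

/-- `f : E → J^k(E/V)` is the homomorphism produced by `D`: through every `v ∈ E_x` there is a flat
section near `x`, and `f` sends `v` to the `k`-jet at `x` of the image in `E/V` of that section. -/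
def IsFlatJetMap (D : CovariantDerivative 𝓘(ℂ, ℂ) F E) (V : ∀ x, Submodule ℂ (E x)) (k : ℕ)
    (f : ∀ x, E x →ₗ[ℂ] JetFiber (quotGerms F V) k x) : Prop :=
  ∀ x v, (∃ s, IsFlatThrough D x v s) ∧
    ∀ s, IsFlatThrough D x v s → f x v = jetAt (quotGerms F V) k x (fun y => (V y).mkQ (s y))

/-! ### The dual connection -/

/-- The value `d(φ(s)) - φ(D s)` of the dual derivative of `φ` on a section `s`. -/
def dualPairing (D : CovariantDerivative 𝓘(ℂ, ℂ) F E) (φ : Π y, Dual E y) (x : X)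
    (v : TangentSpace 𝓘(ℂ, ℂ) x) (s : Π y, E y) : ℂ :=
  mvfderiv 𝓘(ℂ, ℂ) (fun y => (φ y (s y) : ℂ)) x v - φ x (D s x v)

theorem dualPairing_tensorial (D : CovariantDerivative 𝓘(ℂ, ℂ) F E) {φ : Π y, Dual E y} {x : X}
    (hφ : MDifferentiableAt 𝓘(ℂ, ℂ) (𝓘(ℂ, ℂ).prod 𝓘(ℂ, F →L[ℂ] ℂ))
      (fun y => TotalSpace.mk' (F →L[ℂ] ℂ) y (φ y)) x) (v : TangentSpace 𝓘(ℂ, ℂ) x) :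
    TensorialAt 𝓘(ℂ, ℂ) F (dualPairing D φ x v) x where
  smul := by
    intro f s hf hs
    have h := mdifferentiableAt_pairing hφ hs
    have e : (fun y => (φ y ((f • s) y) : ℂ)) = fun y => f y • (φ y (s y) : ℂ) := by
      ext y; exact map_smul (φ y) (f y) (s y)
    have e2 := D.isCovariantDerivativeOnUniv.leibniz hs hf
    have e3 := mvfderiv_smul hf h
    have e4 : (φ x ((f x • D s x + (mvfderiv 𝓘(ℂ, ℂ) f x).smulRight (s x)) v) : ℂ)
        = f x * (φ x (D s x v) : ℂ) + mvfderiv 𝓘(ℂ, ℂ) f x v * (φ x (s x) : ℂ) := by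
      have : ((f x • D s x + (mvfderiv 𝓘(ℂ, ℂ) f x).smulRight (s x)) v : E x)
        = f x • D s x v + mvfderiv 𝓘(ℂ, ℂ) f x v • s x := rfl
      rw [this]
      refine (map_add (φ x) _ _).trans ?_
      congr 1
      · exact map_smul (φ x) _ _
      · exact map_smul (φ x) _ _
    unfold dualPairing
    rw [e, e2]
    erw [e3, e4]
    simp
    ring
  add := by
    intro s t hs ht
    have h := mdifferentiableAt_pairing hφ hs
    have h' := mdifferentiableAt_pairing hφ ht
    have e : (fun y => (φ y ((s + t) y) : ℂ)) =
        (fun y => (φ y (s y) : ℂ)) + fun y => (φ y (t y) : ℂ) := by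
      ext y; exact map_add (φ y) (s y) (t y)
    have e2 := D.isCovariantDerivativeOnUniv.add hs ht
    have e3 := mvfderiv_add h h'
    have e4 : (φ x ((D s x + D t x) v) : ℂ) = (φ x (D s x v) : ℂ) + (φ x (D t x v) : ℂ) :=
      map_add (φ x) _ _
    unfold dualPairing
    rw [e, e2]
    erw [e3, e4]
    simp
    ring

variable [FiniteDimensional ℂ F] [ContMDiffVectorBundle ω F E 𝓘(ℂ, ℂ)]

open Classical in
/-- The dual derivative of `φ` (and `0` at points where `φ` is not differentiable). -/
def dualDerivative (D : CovariantDerivative 𝓘(ℂ, ℂ) F E) (φ : Π y, Dual E y) (x : X) :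
    TangentSpace 𝓘(ℂ, ℂ) x →L[ℂ] Dual E x :=
  if hφ : MDifferentiableAt 𝓘(ℂ, ℂ) (𝓘(ℂ, ℂ).prod 𝓘(ℂ, F →L[ℂ] ℂ))
      (fun y => TotalSpace.mk' (F →L[ℂ] ℂ) y (φ y)) x then
    have : FiniteDimensional ℂ (TangentSpace 𝓘(ℂ, ℂ) x) :=
      inferInstanceAs (FiniteDimensional ℂ ℂ)
    have : T2Space (TangentSpace 𝓘(ℂ, ℂ) x) := inferInstanceAs (T2Space ℂ)
    LinearMap.toContinuousLinearMap
      { toFun := fun v => TensorialAt.mkHom _ x (dualPairing_tensorial D hφ v)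
        map_add' := by
          intro v w
          ext u
          change dualPairing D φ x (v + w) (FiberBundle.extend F u) =
            dualPairing D φ x v (FiberBundle.extend F u) +
              dualPairing D φ x w (FiberBundle.extend F u)
          unfold dualPairing
          rw [map_add, map_add]
          erw [map_add (φ x)]
          exact add_sub_add_comm _ _ _ _
        map_smul' := by
          intro c v
          ext u
          change dualPairing D φ x (c • v) (FiberBundle.extend F u) =
            c • dualPairing D φ x v (FiberBundle.extend F u)
          unfold dualPairing
          rw [map_smul, map_smul]
          erw [map_smul (φ x)]
          exact (smul_sub _ _ _).symm }
  else 0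

theorem dualDerivative_apply (D : CovariantDerivative 𝓘(ℂ, ℂ) F E) {φ : Π y, Dual E y} {x : X}
    (hφ : MDifferentiableAt 𝓘(ℂ, ℂ) (𝓘(ℂ, ℂ).prod 𝓘(ℂ, F →L[ℂ] ℂ))
      (fun y => TotalSpace.mk' (F →L[ℂ] ℂ) y (φ y)) x) {s : Π y, E y}
    (hs : MDifferentiableAt 𝓘(ℂ, ℂ) (𝓘(ℂ, ℂ).prod 𝓘(ℂ, F))
      (fun y => TotalSpace.mk' F y (s y)) x) (v : TangentSpace 𝓘(ℂ, ℂ) x) :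
    (dualDerivative D φ x v (s x) : ℂ) =
      mvfderiv 𝓘(ℂ, ℂ) (fun y => (φ y (s y) : ℂ)) x v - φ x (D s x v) := by
  rw [dualDerivative, dif_pos hφ]
  exact TensorialAt.mkHom_apply (dualPairing_tensorial D hφ v) hs

/-- The dual connection. -/
def dualConnection (D : CovariantDerivative 𝓘(ℂ, ℂ) F E) :
    CovariantDerivative 𝓘(ℂ, ℂ) (F →L[ℂ] ℂ) (Dual E) where
  toFun := dualDerivative D
  isCovariantDerivativeOnUniv :=
    { add := by
        intro φ ψ x hφ hψ _
        refine ContinuousLinearMap.ext fun v => ContinuousLinearMap.ext fun u => ?_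
        obtain ⟨s, hs, rfl⟩ : ∃ s : Π y, E y, MDifferentiableAt 𝓘(ℂ, ℂ) (𝓘(ℂ, ℂ).prod 𝓘(ℂ, F))
            (fun y => TotalSpace.mk' F y (s y)) x ∧ s x = u :=
          ⟨FiberBundle.extend F u, FiberBundle.mdifferentiableAt_extend .., by simp⟩
        have h := mvfderiv_add (mdifferentiableAt_pairing hφ hs) (mdifferentiableAt_pairing hψ hs)
        have h' := congrArg (fun L => L v) h
        change (dualDerivative D (φ + ψ) x v (s x) : ℂ) =
          (dualDerivative D φ x v (s x) : ℂ) + (dualDerivative D ψ x v (s x) : ℂ)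
        rw [dualDerivative_apply D hφ hs, dualDerivative_apply D hψ hs,
          dualDerivative_apply D (mdifferentiableAt_add_section hφ hψ) hs]
        refine (congrArg (fun z : ℂ => z - ((φ + ψ) x (D s x v) : ℂ)) h').trans ?_
        exact add_sub_add_comm _ _ _ _
      leibniz := by
        intro φ g x hφ hg _
        refine ContinuousLinearMap.ext fun v => ContinuousLinearMap.ext fun u => ?_
        obtain ⟨s, hs, rfl⟩ : ∃ s : Π y, E y, MDifferentiableAt 𝓘(ℂ, ℂ) (𝓘(ℂ, ℂ).prod 𝓘(ℂ, F))
            (fun y => TotalSpace.mk' F y (s y)) x ∧ s x = u :=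
          ⟨FiberBundle.extend F u, FiberBundle.mdifferentiableAt_extend .., by simp⟩
        have h := mvfderiv_smul hg (mdifferentiableAt_pairing hφ hs)
        have h' := congrArg (fun L => L v) h
        change (dualDerivative D (g • φ) x v (s x) : ℂ) =
          g x * (dualDerivative D φ x v (s x) : ℂ) + mvfderiv 𝓘(ℂ, ℂ) g x v * (φ x (s x) : ℂ)
        rw [dualDerivative_apply D hφ hs, dualDerivative_apply D (hg.smul_section hφ) hs]
        refine (congrArg (fun z : ℂ => z - ((g • φ) x (D s x v) : ℂ)) h').trans ?_
        change g x * mvfderiv 𝓘(ℂ, ℂ) (fun y => (φ y (s y) : ℂ)) x v +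
          mvfderiv 𝓘(ℂ, ℂ) g x v * (φ x (s x) : ℂ) - g x * (φ x (D s x v) : ℂ) = _
        ring }

/-! ### Quasiopers -/

/-- `(E, B)` is an `SO(2n, ℂ)`-bundle: `E` has rank `2n` and trivial determinant (witnessed by a
nowhere vanishing holomorphic section `ω'` of the dual of `⋀^{2n} E`), and `B` is a fibrewise
nondegenerate holomorphic symmetric bilinear form on `E`. -/
structure IsSOBundle (n : ℕ) (B : ∀ x, LinearMap.BilinForm ℂ (E x)) : Prop where
  rank : ∀ x, Module.finrank ℂ (E x) = 2 * n
  det_trivial : ∃ ω' : ∀ x, E x [⋀^Fin (2 * n)]→ₗ[ℂ] ℂ, (∀ x, ω' x ≠ 0) ∧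
    ∀ x, ∀ s : Fin (2 * n) → Π y, E y, (∀ i, s i ∈ holGerms F x) →
      HolAt (fun y => ω' y fun i => s i y) x
  symm : ∀ x, (B x).IsSymm
  nondegenerate : ∀ x, (B x).Nondegenerate
  holomorphic : ∀ x, ∀ s ∈ holGerms F x, ∀ t ∈ holGerms F x, HolAt (fun y => B y (s y) (t y)) x

/-- `0 = Fil 0 ⊆ Fil 1 ⊆ ⋯ ⊆ Fil (2m+1) = E` is a filtration of length `2m+1` of the
`SO(2n, ℂ)`-bundle `(E, B)`. The values `Fil i` for `i > 2m+1` play no role. -/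
structure IsSOFiltration (m : ℕ) (B : ∀ x, LinearMap.BilinForm ℂ (E x))
    (Fil : ℕ → ∀ x, Submodule ℂ (E x)) : Prop where
  zero : Fil 0 = ⊥
  top : Fil (2 * m + 1) = ⊤
  subbundle : ∀ i ≤ 2 * m + 1, IsHolSubbundle F (Fil i)
  mono : ∀ i ≤ 2 * m, Fil i ≤ Fil (i + 1)
  rank_middle : ∀ x, Module.finrank ℂ (Gr (Fil m) (Fil (m + 1)) x) =
    2 * Module.finrank ℂ (Fil 1 x)
  rank_gr : ∀ i ∈ Finset.Icc 1 (2 * m + 1), i ≠ m + 1 →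
    ∀ x, Module.finrank ℂ (Gr (Fil (i - 1)) (Fil i) x) = Module.finrank ℂ (Fil 1 x)
  perp : ∀ i ≤ m, ∀ x, (B x).orthogonal (Fil i x) = Fil (2 * m + 1 - i) x

/-- `D` is a holomorphic connection on the filtered `SO(2n, ℂ)`-bundle `(E, B, Fil)`. -/
structure IsFilteredConnection (m : ℕ) (B : ∀ x, LinearMap.BilinForm ℂ (E x))
    (Fil : ℕ → ∀ x, Submodule ℂ (E x)) (D : CovariantDerivative 𝓘(ℂ, ℂ) F E) : Prop where
  holomorphic : IsHolConnection D
  compatible : ∀ x, ∀ s ∈ holGerms F x, ∀ t ∈ holGerms F x, ∀ v : TangentSpace 𝓘(ℂ, ℂ) x,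
    mvfderiv 𝓘(ℂ, ℂ) (fun y => B y (s y) (t y)) x v = B x (D s x v) (t x) + B x (s x) (D t x v)
  transversal : ∀ i ∈ Finset.Icc 1 (2 * m), MapsInto D (Fil i) (Fil (i + 1))
  iso : ∀ i ∈ Finset.Icc 1 (2 * m), i ≠ m → i ≠ m + 1 →
    ∃ S, IsSecondFundamentalForm D (Fil (i - 1)) (Fil i) (Fil i) (Fil (i + 1)) S ∧
      ∀ x, Function.Bijective (S x)
  /-- The fibre of `(Fil (m+2) / Fil (m+1)) ⊗ K ⊗ K` at `x` is the space of bilinear maps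
  `T_x X × T_x X → Fil (m+2) x / Fil (m+1) x`. -/
  iso_middle :
    ∃ S S', IsSecondFundamentalForm D (Fil (m - 1)) (Fil m) (Fil m) (Fil (m + 1)) S ∧
      IsSecondFundamentalForm D (Fil m) (Fil (m + 1)) (Fil (m + 1)) (Fil (m + 2)) S' ∧
      ∀ x, Function.Bijective fun u => S' x ∘ₗ S x u

/-- `(E, B, Fil, D)` is a generalized `SO(2n, ℂ)`-quasioper with filtration length `2m+1`. -/
structure IsQuasioper (n m : ℕ) (B : ∀ x, LinearMap.BilinForm ℂ (E x))
    (Fil : ℕ → ∀ x, Submodule ℂ (E x)) (D : CovariantDerivative 𝓘(ℂ, ℂ) F E) : Prop where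
  bundle : IsSOBundle (F := F) n B
  filtration : IsSOFiltration (F := F) m B Fil
  connection : IsFilteredConnection m B Fil D

/-- The subbundle `𝔽 = D̂^{2m}(F₁)` of `E`. -/
def subF (m : ℕ) (Fil : ℕ → ∀ x, Submodule ℂ (E x)) (D : CovariantDerivative 𝓘(ℂ, ℂ) F E) :
    ∀ x, Submodule ℂ (E x) :=
  (Dhat D)^[2 * m] (Fil 1)

/-- The kernel of the restriction map `E^* → V^*`. -/
def dualAnnihilator (V : ∀ x, Submodule ℂ (E x)) (x : X) : Submodule ℂ (Dual E x) where
  carrier := {φ | ∀ v ∈ V x, (φ v : ℂ) = 0}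
  add_mem' := fun {φ ψ} hφ hψ v hv => by
    have : ((φ + ψ) v : ℂ) = (φ v : ℂ) + (ψ v : ℂ) := rfl
    rw [this, hφ v hv, hψ v hv, add_zero]
  zero_mem' := fun _ _ => rfl
  smul_mem' := fun c φ hφ v hv => by
    have : ((c • φ) v : ℂ) = c * (φ v : ℂ) := rfl
    rw [this, hφ v hv, mul_zero]

/-- The subbundle `𝔾 = (D̂^*)^{2m}(G₁)` of `E^*`, where `G₁` is the kernel of
`E^* → (F_{2m})^*`. -/
def subG (m : ℕ) (Fil : ℕ → ∀ x, Submodule ℂ (E x)) (D : CovariantDerivative 𝓘(ℂ, ℂ) F E) :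
    ∀ x, Submodule ℂ (Dual E x) :=
  (Dhat (dualConnection D))^[2 * m] (dualAnnihilator (Fil (2 * m)))

/-- The subbundle `𝒮 = (E^*/𝔾)^*` of `E^{**} = E`: the vectors on which all elements of `𝔾`
vanish. -/
def subS (m : ℕ) (Fil : ℕ → ∀ x, Submodule ℂ (E x)) (D : CovariantDerivative 𝓘(ℂ, ℂ) F E)
    (x : X) : Submodule ℂ (E x) where
  carrier := {v | ∀ φ ∈ subG m Fil D x, (φ v : ℂ) = 0}
  add_mem' := fun {v w} hv hw φ hφ => by
    have : (φ (v + w) : ℂ) = (φ v : ℂ) + (φ w : ℂ) := map_add φ v w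
    rw [this, hv φ hφ, hw φ hφ, add_zero]
  zero_mem' := fun φ _ => map_zero φ
  smul_mem' := fun c v hv φ hφ => by
    have : (φ (c • v) : ℂ) = c * (φ v : ℂ) := map_smul φ c v
    rw [this, hv φ hφ, mul_zero]

end Connections

end Quasioper

end

/-! Everything is read off one invertible Gram matrix. Near a point choose a holomorphic frame `s_i`
of `F₁` and put `e_j = ∇^j s` for `0 ≤ j ≤ 2m`, where `∇` is the derivative along a coordinate
field. Transversality gives `e_j ∈ F_{j+1}`, so `B(e_0, e_k) = 0` for `k < 2m`, because `F_{2m} =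
F₁^⊥`. Differentiating these relations moves derivatives from one argument to the other: `B(e_j,
e_k) = 0` for `j + k < 2m`, and `B(e_j, e_k) = (-1)^j B(e_0, e_{2m})` for `j + k = 2m`. The block
`B(e_0, e_{2m})` is invertible, since the composite of all second fundamental forms carries `F₁`
injectively into `E / F_{2m}` and `B` pairs that quotient with `F₁`. Thus the Gram matrix is
antitriangular with invertible antidiagonal blocks (`exists_gramFrame`, resting on
`eq_zero_of_sum_mem_fil` and `eq_zero_of_antitriangular_gram`).

Three consequences finish the proof. The `e_j` are independent, so each application of `Dhat` adds
exactly one more derivative and `𝔽` is the span of all `e_j` (`eventually_iterate_Dhat_eq`). Since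
`D` preserves `B`, the form carries `D` to the dual connection and `F₁` to `G₁`, hence `𝔽` to `𝔾`;
therefore `𝒮 = 𝔽^⊥`. Finally, if `w` is flat then the functions `B(e_0, w)` are coordinates of
`q(w)` and their `j`-th derivatives are `B(e_j, w)`; so in Taylor coordinates on the jet bundle the
map is `v ↦ (B(e_j, v))_j` (`exists_gramFrame_jetCoord`). On `𝔽` this is the Gram matrix, hence an
isomorphism, and its kernel is `𝔽^⊥ = 𝒮`.

Flat sections exist by solving a linear differential equation with power series
(`exists_analyticAt_deriv_eq_mul`, `exists_isFlatThrough`). -/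

noncomputable section

set_option linter.unusedSectionVars false

namespace Quasioper

/-! ### Linear differential equations with holomorphic coefficients, by majorized power series. -/

section ODE

variable {𝔸 : Type*} [NormedRing 𝔸] [NormedAlgebra ℂ 𝔸]

/-- The Taylor coefficients of the solution of `Y' = A * Y`, `Y 0 = 1`, where `A` has the Taylor
coefficients `a`. -/
def odeCoeff (a : ℕ → 𝔸) : ℕ → 𝔸
  | 0 => 1
  | k + 1 => ((k + 1 : ℕ) : ℂ)⁻¹ • ∑ j : Fin (k + 1), a (k - j) * odeCoeff a j
decreasing_by exact j.2

theorem succ_smul_odeCoeff (a : ℕ → 𝔸) (k : ℕ) :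
    ((k + 1 : ℕ) : ℂ) • odeCoeff a (k + 1) =
      ∑ p ∈ Finset.HasAntidiagonal.antidiagonal k, a p.1 * odeCoeff a p.2 := by
  rw [odeCoeff, smul_inv_smul₀ (by exact_mod_cast k.succ_ne_zero),
    ← Finset.Nat.sum_antidiagonal_swap, Finset.Nat.sum_antidiagonal_eq_sum_range_succ_mk,
    Finset.sum_range]
  rfl

/-- Each of the `k + 1` summands of the recursion is at most `M * ρ ^ k` times the norm of `1`; the
factor `1 / (k + 1)` cancels their number, and `M ≤ ρ` absorbs the constant. -/
theorem norm_odeCoeff_le {a : ℕ → 𝔸} {M ρ : ℝ} (ha : ∀ j, ‖a j‖ ≤ M * ρ ^ j) (hM : 0 ≤ M)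
    (hρ : 0 ≤ ρ) (hMρ : M ≤ ρ) (k : ℕ) : ‖odeCoeff a k‖ ≤ ‖(1 : 𝔸)‖ * ρ ^ k := by
  induction k using Nat.strong_induction_on with
  | _ k ih =>
    cases k with
    | zero => rw [odeCoeff]; simp
    | succ k =>
      rw [odeCoeff, norm_smul, norm_inv, Complex.norm_natCast, inv_mul_le_iff₀ (by positivity)]
      calc ‖∑ j : Fin (k + 1), a (k - j) * odeCoeff a j‖
          ≤ ∑ j : Fin (k + 1), ‖(1 : 𝔸)‖ * ρ ^ (k + 1) := by
            refine norm_sum_le_of_le _ fun j _ => ?_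
            have hj : (k - j : ℕ) + j = k := Nat.sub_add_cancel (Nat.lt_succ_iff.1 j.2)
            calc ‖a (k - j) * odeCoeff a j‖ ≤ ‖a (k - j)‖ * ‖odeCoeff a j‖ := norm_mul_le _ _
              _ ≤ (M * ρ ^ (k - j : ℕ)) * (‖(1 : 𝔸)‖ * ρ ^ (j : ℕ)) := by
                gcongr
                · exact ha _
                · exact ih _ j.2
              _ = M * (‖(1 : 𝔸)‖ * (ρ ^ (k - j : ℕ) * ρ ^ (j : ℕ))) := by ring
              _ = M * (‖(1 : 𝔸)‖ * ρ ^ k) := by rw [← pow_add, hj]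
              _ ≤ ρ * (‖(1 : 𝔸)‖ * ρ ^ k) := by gcongr
              _ = _ := by ring
        _ = _ := by simp

/-- A linear differential equation with holomorphic coefficients has a holomorphic fundamental
solution near every point. -/
theorem exists_analyticAt_deriv_eq_mul [CompleteSpace 𝔸] {A : ℂ → 𝔸} {z₀ : ℂ}
    (hA : AnalyticAt ℂ A z₀) :
    ∃ Y : ℂ → 𝔸, AnalyticAt ℂ Y z₀ ∧ Y z₀ = 1 ∧ ∀ᶠ z in 𝓝 z₀, deriv Y z = A z * Y z := by
  obtain ⟨p, hp⟩ := hA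
  obtain ⟨C, r, hC, hr, hCr⟩ := p.le_mul_pow_of_radius_pos hp.radius_pos
  set a : ℕ → 𝔸 := p.coeff
  set ρ : ℝ := max C r
  have hρ : 0 < ρ := lt_max_of_lt_left hC
  have ha : ∀ j, ‖a j‖ ≤ C * ρ ^ j := fun j => by
    have : ‖a j‖ ≤ ‖p j‖ := by
      have := (p j).le_opNorm 1
      simp only [Pi.one_apply, norm_one, Finset.prod_const_one, mul_one] at this
      exact this
    refine this.trans ((hCr j).trans ?_)
    gcongr
    exact le_max_right _ _
  set c := odeCoeff a
  have hc : ∀ k, ‖c k‖ ≤ ‖(1 : 𝔸)‖ * ρ ^ k :=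
    norm_odeCoeff_le ha hC.le hρ.le (le_max_left _ _)
  -- On this radius both series are dominated by a geometric series of ratio `1 / 2`.
  set R : ℝ := (2 * ρ)⁻¹
  have hR : 0 < R := by positivity
  have hρR : ρ * R = 1 / 2 := by simp only [R]; field_simp
  -- bounds on the ball of radius `R`
  have hcw : ∀ w : ℂ, ‖w‖ ≤ R → ∀ k, ‖w ^ k • c k‖ ≤ ‖(1 : 𝔸)‖ * (1 / 2) ^ k := by
    intro w hw k
    rw [norm_smul, norm_pow]
    calc ‖w‖ ^ k * ‖c k‖ ≤ R ^ k * (‖(1 : 𝔸)‖ * ρ ^ k) := by gcongr; exact hc k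
      _ = ‖(1 : 𝔸)‖ * (1 / 2) ^ k := by rw [← hρR, mul_pow]; ring
  have haw : ∀ w : ℂ, ‖w‖ ≤ R → ∀ k, ‖w ^ k • a k‖ ≤ C * (1 / 2) ^ k := by
    intro w hw k
    rw [norm_smul, norm_pow]
    calc ‖w‖ ^ k * ‖a k‖ ≤ R ^ k * (C * ρ ^ k) := by gcongr; exact ha k
      _ = C * (1 / 2) ^ k := by rw [← hρR, mul_pow]; ring
  have hgeo : Summable fun k : ℕ => ((1 : ℝ) / 2) ^ k := summable_geometric_two
  set Y₀ : ℂ → 𝔸 := fun w => ∑' k, w ^ k • c k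
  have hderiv : ∀ w ∈ Metric.ball (0 : ℂ) R,
      HasDerivAt Y₀ (∑' k : ℕ, ((k : ℂ) * w ^ (k - 1)) • c k) w := by
    intro w hw
    -- The majorant comes from `k * R ^ (k - 1) * ρ ^ k = k * (1 / 2) ^ k * (2 * ρ)`.
    have hu : Summable fun k : ℕ => (k : ℝ) * (1 / 2) ^ k * (‖(1 : 𝔸)‖ * (2 * ρ)) := by
      refine Summable.mul_right _ ?_
      simpa using summable_pow_mul_geometric_of_norm_lt_one (R := ℝ) 1 (r := 1 / 2) (by norm_num)
    refine hasDerivAt_tsum_of_isPreconnected (g := fun k w => w ^ k • c k)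
      (g' := fun k w => ((k : ℂ) * w ^ (k - 1)) • c k) (u := fun k : ℕ =>
      (k : ℝ) * (1 / 2) ^ k * (‖(1 : 𝔸)‖ * (2 * ρ))) (t := Metric.ball 0 R) (y₀ := 0) hu
      Metric.isOpen_ball (convex_ball _ _).isPreconnected ?_ ?_ (by simpa using hR) ?_ hw
    · intro k w _
      exact HasDerivAt.smul_const (hasDerivAt_pow k w) (c k)
    · intro k w hw
      cases k with
      | zero => simp
      | succ k =>
        have hw' : ‖w‖ ≤ R := by simpa using (mem_ball_zero_iff.1 hw).le
        rw [norm_smul, norm_mul, norm_pow, Complex.norm_natCast, Nat.add_sub_cancel]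
        calc ((k + 1 : ℕ) : ℝ) * ‖w‖ ^ k * ‖c (k + 1)‖
            ≤ ((k + 1 : ℕ) : ℝ) * R ^ k * (‖(1 : 𝔸)‖ * ρ ^ (k + 1)) := by
              gcongr; exact hc _
          _ = ((k + 1 : ℕ) : ℝ) * (ρ * R) ^ k * (‖(1 : 𝔸)‖ * ρ) := by rw [mul_pow]; ring
          _ = _ := by rw [hρR]; ring
    · exact .of_norm_bounded (hgeo.mul_left _) (hcw 0 (by simpa using hR.le))
  have hda : ∀ z ∈ Metric.ball z₀ R, HasDerivAt (fun z => Y₀ (z - z₀))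
      (∑' k : ℕ, ((k : ℂ) * (z - z₀) ^ (k - 1)) • c k) z := by
    intro z hz
    have := hderiv (z - z₀) (by simpa [dist_eq_norm] using hz)
    simpa using this.comp_sub_const z z₀
  have hball : Metric.ball z₀ R ∈ 𝓝 z₀ := Metric.ball_mem_nhds _ hR
  refine ⟨fun z => Y₀ (z - z₀), ?_, ?_, ?_⟩
  · exact DifferentiableOn.analyticAt
      (fun z hz => (hda z hz).differentiableAt.differentiableWithinAt) hball
  · change ∑' k, (z₀ - z₀) ^ k • c k = 1
    rw [tsum_eq_single 0 (fun k hk => by simp [hk])]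
    simp [c, odeCoeff]
  · have hev := (hasFPowerSeriesAt_iff.1 hp)
    have hev' : ∀ᶠ z in 𝓝 z₀, HasSum (fun n => (z - z₀) ^ n • a n) (A z) := by
      have ht : Tendsto (fun z => z - z₀) (𝓝 z₀) (𝓝 0) := by
        have : ContinuousAt (fun z => z - z₀) z₀ := by fun_prop
        simpa [ContinuousAt] using this
      filter_upwards [ht.eventually hev] with z hz
      simpa using hz
    filter_upwards [hball, hev'] with z hz hAz
    have hw' : ‖z - z₀‖ ≤ R := by simpa [dist_eq_norm] using (Metric.mem_ball.1 hz).le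
    have hsa : Summable fun k => ‖(z - z₀) ^ k • a k‖ :=
      .of_nonneg_of_le (fun _ => norm_nonneg _) (haw _ hw') (hgeo.mul_left _)
    have hsc : Summable fun k => ‖(z - z₀) ^ k • c k‖ :=
      .of_nonneg_of_le (fun _ => norm_nonneg _) (hcw _ hw') (hgeo.mul_left _)
    -- The term of index `0` vanishes, and by the recursion the series shifted by one is the Cauchy
    -- product of the series of the coefficient and of the solution.
    have hsd : Summable fun k : ℕ => ((k : ℂ) * (z - z₀) ^ (k - 1)) • c k := by
      refine (summable_nat_add_iff 1).1 ?_
      have := (summable_norm_sum_mul_antidiagonal_of_summable_norm hsa hsc).of_norm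
      refine this.congr fun k => ?_
      rw [Nat.add_sub_cancel, mul_comm, mul_smul, succ_smul_odeCoeff, Finset.smul_sum]
      refine Finset.sum_congr rfl fun p hp => ?_
      rw [smul_mul_smul_comm, ← pow_add, Finset.HasAntidiagonal.mem_antidiagonal.1 hp]
    rw [(hda z hz).deriv, ← hAz.tsum_eq,
      tsum_mul_tsum_eq_tsum_sum_antidiagonal_of_summable_norm hsa hsc, hsd.tsum_eq_zero_add]
    simp only [Nat.cast_zero, zero_mul, zero_smul, zero_add, Nat.add_sub_cancel]
    refine tsum_congr fun k => ?_
    rw [mul_comm, mul_smul, succ_smul_odeCoeff, Finset.smul_sum]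
    refine Finset.sum_congr rfl fun p hp => ?_
    rw [smul_mul_smul_comm, ← pow_add, Finset.HasAntidiagonal.mem_antidiagonal.1 hp]

end ODE

/-! ### Holomorphic functions on the surface, Cramer's rule, and the coordinate vector field. -/

section HolFunctions

variable {X : Type*} [TopologicalSpace X] [ChartedSpace ℂ X]

theorem HolAt.congr {g g' : X → ℂ} {x : X} (hg : HolAt g x) (h : ∀ᶠ y in 𝓝 x, g' y = g y) :
    HolAt g' x :=
  ContMDiffAt.congr_of_eventuallyEq hg h

theorem HolAt.sum {ι : Type*} {s : Finset ι} {g : ι → X → ℂ} {x : X} (h : ∀ i ∈ s, HolAt (g i) x) :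
    HolAt (fun y => ∑ i ∈ s, g i y) x :=
  contMDiffAt_finsetSum h

theorem HolAt.prod {ι : Type*} {s : Finset ι} {g : ι → X → ℂ} {x : X}
    (h : ∀ i ∈ s, HolAt (g i) x) : HolAt (fun y => ∏ i ∈ s, g i y) x :=
  contMDiffAt_finsetProd h

theorem HolAt.mul {g g' : X → ℂ} {x : X} (h : HolAt g x) (h' : HolAt g' x) :
    HolAt (fun y => g y * g' y) x :=
  ContMDiffAt.mul h h'

theorem holAt_const (c : ℂ) (x : X) : HolAt (fun _ => c) x :=
  contMDiffAt_const

theorem HolAt.mdifferentiableAt {g : X → ℂ} {x : X} (h : HolAt g x) :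
    MDifferentiableAt 𝓘(ℂ, ℂ) 𝓘(ℂ, ℂ) g x :=
  ContMDiffAt.mdifferentiableAt h (by simp)

theorem HolAt.inv {g : X → ℂ} {x : X} (h : HolAt g x) (h0 : g x ≠ 0) :
    HolAt (fun y => (g y)⁻¹) x :=
  ContMDiffAt.inv₀ h h0

theorem holAt_det {ι : Type*} [Fintype ι] [DecidableEq ι] {M : X → Matrix ι ι ℂ} {x : X}
    (hM : ∀ i j, HolAt (fun y => M y i j) x) : HolAt (fun y => (M y).det) x := by
  simp only [Matrix.det_apply']
  exact HolAt.sum fun σ _ => (holAt_const _ _).mul (HolAt.prod fun i _ => hM _ _)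

/-- The solution of a nondegenerate holomorphic system of linear equations is holomorphic. -/
theorem holAt_of_mulVec_eq {ι : Type*} [Fintype ι] [DecidableEq ι] {M : X → Matrix ι ι ℂ}
    {u c : X → ι → ℂ} {x : X} (hM : ∀ i j, HolAt (fun y => M y i j) x)
    (hc : ∀ i, HolAt (fun y => c y i) x) (hdet : (M x).det ≠ 0)
    (h : ∀ᶠ y in 𝓝 x, (M y).mulVec (u y) = c y) (i : ι) : HolAt (fun y => u y i) x := by
  have hd := holAt_det hM
  -- The numerator in Cramer's rule.
  have hcr : HolAt (fun y => ((M y).updateCol i (c y)).det) x := by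
    refine holAt_det fun a b => ?_
    simp only [Matrix.updateCol_apply]
    split_ifs
    · exact hc a
    · exact hM a b
  refine ((hd.inv hdet).mul hcr).congr ?_
  filter_upwards [h, hd.continuousAt.eventually_ne hdet] with y hy hy0
  have h1 : (M y).cramer (c y) = (M y).det • u y := by
    rw [← hy, Matrix.cramer_eq_adjugate_mulVec, Matrix.mulVec_mulVec, Matrix.adjugate_mul,
      Matrix.smul_mulVec, Matrix.one_mulVec]
  have h2 := congrFun h1 i
  rw [Matrix.cramer_apply] at h2
  rw [h2]
  simp [hy0]

theorem eventually_mem_chart_source (x : X) : ∀ᶠ y in 𝓝 x, y ∈ (chartAt ℂ x).source :=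
  (chartAt ℂ x).open_source.mem_nhds (mem_chart_source ℂ x)

theorem mvfderiv_congr {g g' : X → ℂ} {x : X} (h : g' =ᶠ[𝓝 x] g) :
    mvfderiv 𝓘(ℂ, ℂ) g' x = mvfderiv 𝓘(ℂ, ℂ) g x := by
  unfold mvfderiv
  rw [h.mfderiv_eq, h.eq_of_nhds]

variable [IsManifold 𝓘(ℂ, ℂ) ω X]

theorem holAt_iff_analyticAt {g : X → ℂ} {x y : X} (hy : y ∈ (chartAt ℂ x).source) :
    HolAt g y ↔ AnalyticAt ℂ (g ∘ (chartAt ℂ x).symm) (chartAt ℂ x y) := by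
  rw [HolAt, contMDiffAt_iff_source_of_mem_source hy]
  simp only [mfld_simps, contMDiffWithinAt_univ, contMDiffAt_iff_contDiffAt]
  exact ⟨fun h => h.analyticAt, fun h => h.contDiffAt⟩

/-- The holomorphic tangent vector field `d/dz`, where `z` is the preferred chart at `x`. -/
def dz (x y : X) : TangentSpace 𝓘(ℂ, ℂ) y :=
  (trivializationAt ℂ (TangentSpace 𝓘(ℂ, ℂ)) x).symmL ℂ y (1 : ℂ)

/-- This converts the intrinsic derivative along the coordinate field into the ordinary complex
derivative in the chart; all Taylor expansions below pass through it. -/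
theorem mvfderiv_dz {g : X → ℂ} {x y : X} (hy : y ∈ (chartAt ℂ x).source)
    (hg : MDifferentiableAt 𝓘(ℂ, ℂ) 𝓘(ℂ, ℂ) g y) :
    mvfderiv 𝓘(ℂ, ℂ) g y (dz x y) = deriv (g ∘ (chartAt ℂ x).symm) (chartAt ℂ x y) := by
  obtain ⟨w, hw, rfl⟩ : ∃ w ∈ (chartAt ℂ x).target, (chartAt ℂ x).symm w = y :=
    ⟨_, (chartAt ℂ x).map_source hy, (chartAt ℂ x).left_inv hy⟩
  have hs : MDifferentiableAt 𝓘(ℂ, ℂ) 𝓘(ℂ, ℂ) (chartAt ℂ x).symm w :=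
    mdifferentiableAt_atlas_symm (chart_mem_atlas ℂ x) hw
  have hinv : chartAt ℂ x ((chartAt ℂ x).symm w) = w := (chartAt ℂ x).right_inv hw
  have h2 : dz x ((chartAt ℂ x).symm w) =
      mfderiv 𝓘(ℂ, ℂ) 𝓘(ℂ, ℂ) (chartAt ℂ x).symm w (1 : ℂ) := by
    rw [dz, TangentBundle.symmL_trivializationAt hy]
    -- The tangent spaces at two equal base points are different types, so the comparison is made in
    -- `ℂ`, with the base point as a free variable.
    have key : ∀ w' : ℂ, w' = w →
        (mfderiv 𝓘(ℂ, ℂ) 𝓘(ℂ, ℂ) (chartAt ℂ x).symm w' (1 : ℂ) : ℂ) =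
          mfderiv 𝓘(ℂ, ℂ) 𝓘(ℂ, ℂ) (chartAt ℂ x).symm w (1 : ℂ) := by
      rintro _ rfl
      rfl
    simp only [mfld_simps, mfderivWithin_univ]
    exact key _ hinv
  have h3 : mvfderiv 𝓘(ℂ, ℂ) (g ∘ (chartAt ℂ x).symm) w (1 : ℂ) =
      deriv (g ∘ (chartAt ℂ x).symm) w := by
    rw [mvfderiv, mfderiv_eq_fderiv]
    rfl
  rw [hinv, ← h3, mvfderiv_comp w hg hs, h2]
  rfl

theorem exists_eq_smul_dz {x y : X} (hy : y ∈ (chartAt ℂ x).source)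
    (v : TangentSpace 𝓘(ℂ, ℂ) y) : ∃ c : ℂ, v = c • dz x y := by
  have hy' : y ∈ (trivializationAt ℂ (TangentSpace 𝓘(ℂ, ℂ)) x).baseSet := by simpa using hy
  refine ⟨(trivializationAt ℂ (TangentSpace 𝓘(ℂ, ℂ)) x).continuousLinearMapAt ℂ y v, ?_⟩
  rw [dz, ← map_smul, smul_eq_mul, mul_one,
    Trivialization.symmL_continuousLinearMapAt _ hy']

end HolFunctions

/-! ### Holomorphic sections, independence as an open condition, and holomorphic coefficients. -/

section HolSections

variable {X : Type*} [TopologicalSpace X] [ChartedSpace ℂ X]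
  {F : Type*} [NormedAddCommGroup F] [NormedSpace ℂ F]
  {E : X → Type*} [TopologicalSpace (TotalSpace F E)]
  [∀ x, AddCommGroup (E x)] [∀ x, Module ℂ (E x)] [∀ x, TopologicalSpace (E x)]
  [FiberBundle F E] [VectorBundle ℂ F E]

theorem holGerms_congr {s t : Π y, E y} {x : X} (hs : s ∈ holGerms F x)
    (h : ∀ᶠ y in 𝓝 x, t y = s y) : t ∈ holGerms F x :=
  ContMDiffAt.congr_of_eventuallyEq hs (h.mono fun y hy => congrArg (TotalSpace.mk' F y) hy)

theorem smul_mem_holGerms {g : X → ℂ} {s : Π y, E y} {x : X} (hg : HolAt g x)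
    (hs : s ∈ holGerms F x) : (fun y => g y • s y) ∈ holGerms F x :=
  ContMDiffAt.smul_section hg hs

theorem sum_smul_mem_holGerms {ι : Type*} {t : Finset ι} {g : ι → X → ℂ} {s : ι → Π y, E y} {x : X}
    (hg : ∀ i ∈ t, HolAt (g i) x) (hs : ∀ i ∈ t, s i ∈ holGerms F x) :
    (fun y => ∑ i ∈ t, g i y • s i y) ∈ holGerms F x := by
  have := Submodule.sum_mem (holGerms F x) fun i hi => smul_mem_holGerms (hg i hi) (hs i hi)
  convert this using 1
  ext y
  simp

theorem mdifferentiableAt_of_mem_holGerms {s : Π y, E y} {x : X} (hs : s ∈ holGerms F x) :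
    MDifferentiableAt 𝓘(ℂ, ℂ) (𝓘(ℂ, ℂ).prod 𝓘(ℂ, F)) (fun y => TotalSpace.mk' F y (s y)) x :=
  ContMDiffAt.mdifferentiableAt hs (by simp)

variable (F) in
theorem finiteDimensional_fiber [FiniteDimensional ℂ F] (x : X) : FiniteDimensional ℂ (E x) :=
  ((trivializationAt F E x).linearEquivAt ℂ x
    (FiberBundle.mem_baseSet_trivializationAt' x)).symm.finiteDimensional

variable (F) in
theorem finrank_fiber (x : X) : Module.finrank ℂ (E x) = Module.finrank ℂ F :=
  ((trivializationAt F E x).linearEquivAt ℂ x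
    (FiberBundle.mem_baseSet_trivializationAt' x)).finrank_eq

/-- Holomorphic functionals which take prescribed linearly independent values to the standard
basis. -/
theorem exists_dual_family [FiniteDimensional ℂ F] {ι : Type*} [Fintype ι] [DecidableEq ι] {x : X}
    {e : ι → E x} (hli : LinearIndependent ℂ e) :
    ∃ L : ∀ y, E y →ₗ[ℂ] (ι → ℂ),
      (∀ σ ∈ holGerms F x, ∀ i, HolAt (fun y => L y (σ y) i) x) ∧
        ∀ i, L x (e i) = Pi.single i 1 := by
  let T := trivializationAt F E x
  have hx : x ∈ T.baseSet := FiberBundle.mem_baseSet_trivializationAt' x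
  have hinj : Function.Injective (T.continuousLinearMapAt ℂ x) := fun v w h => by
    rw [← T.symmL_continuousLinearMapAt (R := ℂ) hx v, h, T.symmL_continuousLinearMapAt hx]
  have hli' : LinearIndependent ℂ fun i => T.continuousLinearMapAt ℂ x (e i) :=
    hli.map' (T.continuousLinearMapAt ℂ x : E x →ₗ[ℂ] F) (LinearMap.ker_eq_bot.2 hinj)
  -- A left inverse is chosen once in the model fibre and moved to nearby fibres by the
  -- trivialization, which makes the functionals holomorphic.
  obtain ⟨L₀, hL₀⟩ := LinearMap.exists_leftInverse_of_injective
    (Fintype.linearCombination ℂ fun i => T.continuousLinearMapAt ℂ x (e i))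
    (LinearMap.ker_eq_bot.2 (hli'.fintypeLinearCombination_injective))
  refine ⟨fun y => L₀ ∘ₗ (T.continuousLinearMapAt ℂ y : E y →ₗ[ℂ] F), fun σ hσ i => ?_, fun i => ?_⟩
  · have h1 : ContMDiffAt 𝓘(ℂ, ℂ) 𝓘(ℂ, F) ω (fun y => (T ⟨y, σ y⟩).2) x :=
      (contMDiffAt_section x).1 hσ
    let ℓ : F →L[ℂ] ℂ := LinearMap.toContinuousLinearMap (LinearMap.proj i ∘ₗ L₀)
    have h2 : HolAt (fun y => ℓ (T ⟨y, σ y⟩).2) x := ℓ.contMDiff.contMDiffAt.comp x h1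
    refine h2.congr ?_
    filter_upwards [T.open_baseSet.mem_nhds hx] with y hy
    simp [ℓ, Trivialization.coe_linearMapAt_of_mem T hy]
  · have := LinearMap.congr_fun hL₀ (Pi.single i 1)
    simpa [Fintype.linearCombination_apply_single] using this

variable {ι : Type*} [Fintype ι]

/-- Pairing with functionals dual to the family at `x` gives a matrix that is the identity at `x`,
so its determinant stays nonzero nearby. -/
theorem eventually_linearIndependent [FiniteDimensional ℂ F] {x : X} {e : ι → Π y, E y}
    (he : ∀ i, e i ∈ holGerms F x) (hli : LinearIndependent ℂ fun i => e i x) :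
    ∀ᶠ y in 𝓝 x, LinearIndependent ℂ fun i => e i y := by
  classical
  obtain ⟨L, hL, hLx⟩ := exists_dual_family (F := F) hli
  have hd := holAt_det (M := fun y => Matrix.of fun i j => L y (e j y) i) (x := x)
    fun i j => hL _ (he j) i
  have h0 : (Matrix.of fun i j => L x (e j x) i).det ≠ 0 := by
    have : (Matrix.of fun i j => L x (e j x) i) = 1 := by
      ext i j
      simp [hLx, Matrix.one_apply, Pi.single_apply]
    simp [this]
  filter_upwards [hd.continuousAt.eventually_ne h0] with y hy
  rw [Fintype.linearIndependent_iff]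
  intro g hg
  have : (Matrix.of fun i j => L y (e j y) i).mulVec g = 0 := by
    ext i
    have := congrFun (congrArg (L y) hg) i
    simpa [Matrix.mulVec, dotProduct, mul_comm] using this
  exact congrFun (Matrix.eq_zero_of_mulVec_eq_zero hy this)

/-- The coefficients of a holomorphic section with respect to linearly independent holomorphic
sections are holomorphic. -/
theorem holAt_coeff [FiniteDimensional ℂ F] {x : X} {e : ι → Π y, E y}
    (he : ∀ i, e i ∈ holGerms F x) (hli : LinearIndependent ℂ fun i => e i x) {σ : Π y, E y}
    (hσ : σ ∈ holGerms F x) {u : X → ι → ℂ} (h : ∀ᶠ y in 𝓝 x, σ y = ∑ i, u y i • e i y) (i : ι) :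
    HolAt (fun y => u y i) x := by
  classical
  obtain ⟨L, hL, hLx⟩ := exists_dual_family (F := F) hli
  refine holAt_of_mulVec_eq (M := fun y => Matrix.of fun i j => L y (e j y) i)
    (c := fun y => L y (σ y)) (fun i j => hL _ (he j) i) (hL σ hσ) ?_ ?_ i
  · have : (Matrix.of fun i j => L x (e j x) i) = 1 := by
      ext i j
      simp [hLx, Matrix.one_apply, Pi.single_apply]
    simp [this]
  · filter_upwards [h] with y hy
    ext i
    simp [hy, Matrix.mulVec, dotProduct, mul_comm]

theorem exists_holAt_coeff [FiniteDimensional ℂ F] {x : X} {e : ι → Π y, E y}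
    (he : ∀ i, e i ∈ holGerms F x) (hli : LinearIndependent ℂ fun i => e i x) {σ : Π y, E y}
    (hσ : σ ∈ holGerms F x)
    (h : ∀ᶠ y in 𝓝 x, σ y ∈ Submodule.span ℂ (Set.range fun i => e i y)) :
    ∃ u : ι → X → ℂ, (∀ i, HolAt (u i) x) ∧ ∀ᶠ y in 𝓝 x, σ y = ∑ i, u i y • e i y := by
  classical
  have h' : ∀ y, ∃ c : ι → ℂ, σ y ∈ Submodule.span ℂ (Set.range fun i => e i y) →
      σ y = ∑ i, c i • e i y := by
    intro y
    by_cases hy : σ y ∈ Submodule.span ℂ (Set.range fun i => e i y)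
    · obtain ⟨c, hc⟩ := (Submodule.mem_span_range_iff_exists_fun ℂ).1 hy
      exact ⟨c, fun _ => hc.symm⟩
    · exact ⟨0, fun h => absurd h hy⟩
  choose u hu using h'
  have := h.mono fun y hy => hu y hy
  exact ⟨fun i y => u y i, holAt_coeff he hli hσ this, this⟩

end HolSections

section HolBundles

variable {X : Type*} [TopologicalSpace X] [ChartedSpace ℂ X] [IsManifold 𝓘(ℂ, ℂ) ω X]
  {F : Type*} [NormedAddCommGroup F] [NormedSpace ℂ F]
  {E : X → Type*} [TopologicalSpace (TotalSpace F E)]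
  [∀ x, AddCommGroup (E x)] [∀ x, Module ℂ (E x)] [∀ x, TopologicalSpace (E x)]
  [FiberBundle F E] [VectorBundle ℂ F E] [ContMDiffVectorBundle ω F E 𝓘(ℂ, ℂ)]

theorem eventually_mem_holGerms {s : Π y, E y} {x : X} (hs : s ∈ holGerms F x) :
    ∀ᶠ y in 𝓝 x, s ∈ holGerms F y :=
  (contMDiffAt_iff_contMDiffAt_nhds (by simp)).1 hs

/-- The sections which are constant in a trivialization are holomorphic. -/
theorem symmL_mem_holGerms (x : X) (w : F) :
    (fun y => (trivializationAt F E x).symmL ℂ y w) ∈ holGerms F x := by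
  let T := trivializationAt F E x
  have hx : x ∈ T.baseSet := FiberBundle.mem_baseSet_trivializationAt' x
  refine (T.contMDiffAt_section_iff hx).2 ?_
  refine (contMDiffAt_const (c := w)).congr_of_eventuallyEq ?_
  filter_upwards [T.open_baseSet.mem_nhds hx] with y hy
  have := T.continuousLinearMapAt_symmL (R := ℂ) hy w
  rw [Trivialization.continuousLinearMapAt_apply, Trivialization.coe_linearMapAt_of_mem T hy]
    at this
  exact this

variable (F) in
theorem exists_mem_holGerms {x : X} (v : E x) : ∃ s ∈ holGerms F x, s x = v :=
  ⟨FiberBundle.extend F v, FiberBundle.contMDiffAt_extend .., by simp⟩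

end HolBundles

/-! ### Leibniz rule, locality, and the derivative along the coordinate field. -/

section Connections

variable {X : Type*} [TopologicalSpace X] [ChartedSpace ℂ X] [IsManifold 𝓘(ℂ, ℂ) ω X]
  {F : Type*} [NormedAddCommGroup F] [NormedSpace ℂ F]
  {E : X → Type*} [TopologicalSpace (TotalSpace F E)]
  [∀ x, AddCommGroup (E x)] [∀ x, Module ℂ (E x)] [∀ x, TopologicalSpace (E x)]
  [∀ x, IsTopologicalAddGroup (E x)] [∀ x, ContinuousSMul ℂ (E x)]
  [FiberBundle F E] [VectorBundle ℂ F E]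

theorem connection_smul (D : CovariantDerivative 𝓘(ℂ, ℂ) F E) {g : X → ℂ} {s : Π y, E y} {x : X}
    (hg : MDifferentiableAt 𝓘(ℂ, ℂ) 𝓘(ℂ, ℂ) g x) (hs : s ∈ holGerms F x)
    (v : TangentSpace 𝓘(ℂ, ℂ) x) :
    D (fun y => g y • s y) x v = g x • D s x v + mvfderiv 𝓘(ℂ, ℂ) g x v • s x :=
  congrArg (fun L => L v)
    (D.isCovariantDerivativeOnUniv.leibniz (mdifferentiableAt_of_mem_holGerms hs) hg)

theorem connection_add (D : CovariantDerivative 𝓘(ℂ, ℂ) F E) {s t : Π y, E y} {x : X}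
    (hs : s ∈ holGerms F x) (ht : t ∈ holGerms F x) (v : TangentSpace 𝓘(ℂ, ℂ) x) :
    D (s + t) x v = D s x v + D t x v :=
  congrArg (fun L => L v) (D.isCovariantDerivativeOnUniv.add
    (mdifferentiableAt_of_mem_holGerms hs) (mdifferentiableAt_of_mem_holGerms ht))

/-- Sections are arbitrary global extensions of germs, so locality has to be proved. The Leibniz
rule applied to an indicator function does it. -/
theorem connection_congr (D : CovariantDerivative 𝓘(ℂ, ℂ) F E) {s t : Π y, E y} {x : X}
    (hs : s ∈ holGerms F x) (h : ∀ᶠ y in 𝓝 x, t y = s y) (v : TangentSpace 𝓘(ℂ, ℂ) x) :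
    D t x v = D s x v := by
  classical
  -- `g` equals `1` near `x`, and `g • t = g • s` everywhere, even where the two sections differ.
  let g : X → ℂ := fun y => if t y = s y then 1 else 0
  have hg : g =ᶠ[𝓝 x] fun _ => 1 := h.mono fun y hy => by simp [g, hy]
  have hgd : MDifferentiableAt 𝓘(ℂ, ℂ) 𝓘(ℂ, ℂ) g x := ((holAt_const 1 x).congr hg).mdifferentiableAt
  have hg0 : mvfderiv 𝓘(ℂ, ℂ) g x = 0 := by
    rw [mvfderiv_congr hg, mvfderiv_const]
  have e : (fun y => g y • t y) = fun y => g y • s y := by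
    ext y
    by_cases hy : t y = s y <;> simp [g, hy]
  have h1 := connection_smul D hgd hs v
  have h2 := connection_smul D hgd (holGerms_congr hs h) v
  rw [e, h1] at h2
  simpa [hg0, hg.eq_of_nhds] using h2.symm

theorem connection_sum_smul (D : CovariantDerivative 𝓘(ℂ, ℂ) F E) {ι : Type*} (A : Finset ι)
    {g : ι → X → ℂ} {s : ι → Π y, E y} {x : X} (hg : ∀ i ∈ A, HolAt (g i) x)
    (hs : ∀ i ∈ A, s i ∈ holGerms F x) (v : TangentSpace 𝓘(ℂ, ℂ) x) :
    D (fun y => ∑ i ∈ A, g i y • s i y) x v =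
      ∑ i ∈ A, (g i x • D (s i) x v + mvfderiv 𝓘(ℂ, ℂ) (g i) x v • s i x) := by
  classical
  induction A using Finset.induction_on with
  | empty =>
    simp only [Finset.sum_empty]
    exact congrFun (congrArg (fun L => (L x : TangentSpace 𝓘(ℂ, ℂ) x → E x)) D.zero) v
  | insert a A ha ih =>
    simp only [Finset.forall_mem_insert] at hg hs
    rw [Finset.sum_insert ha, ← ih hg.2 hs.2, ← connection_smul D hg.1.mdifferentiableAt hs.1 v,
      ← connection_add D (smul_mem_holGerms hg.1 hs.1) (sum_smul_mem_holGerms hg.2 hs.2)]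
    congr 2
    ext y
    simp [Finset.sum_insert ha]

/-- The covariant derivative in the direction `d/dz`, where `z` is the preferred chart at `x`. -/
def nabla (D : CovariantDerivative 𝓘(ℂ, ℂ) F E) (x : X) (s : Π y, E y) (y : X) : E y :=
  D s y (dz x y)

theorem dz_mem_holGerms (x : X) :
    (fun y => dz x y) ∈ holGerms ℂ (E := fun y : X => TangentSpace 𝓘(ℂ, ℂ) y) x :=
  symmL_mem_holGerms x (1 : ℂ)

theorem nabla_mem_holGerms [ContMDiffVectorBundle ω F E 𝓘(ℂ, ℂ)]
    {D : CovariantDerivative 𝓘(ℂ, ℂ) F E} (hD : IsHolConnection D) {s : Π y, E y}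
    {x : X} (hs : s ∈ holGerms F x) : nabla D x s ∈ holGerms F x :=
  ContMDiffAt.clm_bundle_apply (hD x s hs) (dz_mem_holGerms x)

end Connections

section ChartFunctions

variable {X : Type*} [TopologicalSpace X] [ChartedSpace ℂ X] [IsManifold 𝓘(ℂ, ℂ) ω X]

theorem holAt_comp_chart {h : ℂ → ℂ} {x y : X} (hy : y ∈ (chartAt ℂ x).source)
    (hh : AnalyticAt ℂ h (chartAt ℂ x y)) : HolAt (fun y => h (chartAt ℂ x y)) y := by
  rw [holAt_iff_analyticAt hy]
  refine hh.congr ?_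
  filter_upwards [(chartAt ℂ x).open_target.mem_nhds ((chartAt ℂ x).map_source hy)] with z hz
  simp [(chartAt ℂ x).right_inv hz]

theorem mvfderiv_comp_chart {h : ℂ → ℂ} {x y : X} (hy : y ∈ (chartAt ℂ x).source)
    (hh : AnalyticAt ℂ h (chartAt ℂ x y)) :
    mvfderiv 𝓘(ℂ, ℂ) (fun y => h (chartAt ℂ x y)) y (dz x y) = deriv h (chartAt ℂ x y) := by
  rw [mvfderiv_dz hy (holAt_comp_chart hy hh).mdifferentiableAt]
  refine EventuallyEq.deriv_eq ?_
  filter_upwards [(chartAt ℂ x).open_target.mem_nhds ((chartAt ℂ x).map_source hy)] with z hz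
  simp [(chartAt ℂ x).right_inv hz]

theorem tendsto_chartAt (x : X) : Tendsto (chartAt ℂ x) (𝓝 x) (𝓝 (chartAt ℂ x x)) :=
  (chartAt ℂ x).continuousAt (mem_chart_source ℂ x)

end ChartFunctions

/-! ### Existence of flat sections through every vector. -/

section Connections

variable {X : Type*} [TopologicalSpace X] [ChartedSpace ℂ X] [IsManifold 𝓘(ℂ, ℂ) ω X]
  {F : Type*} [NormedAddCommGroup F] [NormedSpace ℂ F] [FiniteDimensional ℂ F]
  {E : X → Type*} [TopologicalSpace (TotalSpace F E)]
  [∀ x, AddCommGroup (E x)] [∀ x, Module ℂ (E x)] [∀ x, TopologicalSpace (E x)]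
  [∀ x, IsTopologicalAddGroup (E x)] [∀ x, ContinuousSMul ℂ (E x)]
  [FiberBundle F E] [VectorBundle ℂ F E] [ContMDiffVectorBundle ω F E 𝓘(ℂ, ℂ)]

variable (F) in
/-- A basis of the fibre at `x` extends to a holomorphic frame near `x`. -/
theorem exists_holFrame {ι : Type*} [Fintype ι] {x : X} (b : Module.Basis ι ℂ (E x)) :
    ∃ t : ι → Π y, E y, (∀ i, t i ∈ holGerms F x) ∧ ∀ i, t i x = b i := by
  choose t ht htx using fun i => exists_mem_holGerms F (b i)
  exact ⟨t, ht, htx⟩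

theorem eventually_span_eq_top {ι : Type*} [Fintype ι] {x : X} (b : Module.Basis ι ℂ (E x))
    {t : ι → Π y, E y} (ht : ∀ i, t i ∈ holGerms F x) (htx : ∀ i, t i x = b i) :
    ∀ᶠ y in 𝓝 x, LinearIndependent ℂ (fun i => t i y) ∧
      Submodule.span ℂ (Set.range fun i => t i y) = ⊤ := by
  have hli : LinearIndependent ℂ fun i => t i x := by simpa [htx] using b.linearIndependent
  filter_upwards [eventually_linearIndependent ht hli] with y hy
  have := finiteDimensional_fiber F (E := E) y
  refine ⟨hy, hy.span_eq_top_of_card_eq_finrank' ?_⟩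
  rw [finrank_fiber F y, ← finrank_fiber F (E := E) x, Module.finrank_eq_card_basis b]

/-- The tangent space is a line spanned by the coordinate vector, so vanishing in that direction
suffices. -/
theorem connection_eq_zero {D : CovariantDerivative 𝓘(ℂ, ℂ) F E} {x y : X} {s : Π y, E y}
    (hy : y ∈ (chartAt ℂ x).source) (h : nabla D x s y = 0) : D s y = 0 := by
  refine ContinuousLinearMap.ext fun v => ?_
  obtain ⟨c, rfl⟩ := exists_eq_smul_dz hy v
  rw [map_smul]
  change c • nabla D x s y = 0
  rw [h, smul_zero]

theorem exists_isFlatThrough {D : CovariantDerivative 𝓘(ℂ, ℂ) F E} (hD : IsHolConnection D)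
    (x : X) (v : E x) : ∃ s, IsFlatThrough D x v s := by
  classical
  have := finiteDimensional_fiber F (E := E) x
  obtain ⟨n, ⟨b⟩⟩ : ∃ n, Nonempty (Module.Basis (Fin n) ℂ (E x)) :=
    ⟨_, ⟨Module.finBasis ℂ (E x)⟩⟩
  obtain ⟨t, ht, htx⟩ := exists_holFrame F b
  have hspan := eventually_span_eq_top b ht htx
  have hli : LinearIndependent ℂ fun i => t i x := by simpa [htx] using b.linearIndependent
  have ha : ∀ j, ∃ u : Fin n → X → ℂ, (∀ i, HolAt (u i) x) ∧
      ∀ᶠ y in 𝓝 x, nabla D x (t j) y = ∑ i, u i y • t i y := fun j =>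
    exists_holAt_coeff ht hli (nabla_mem_holGerms hD (ht j))
      (hspan.mono fun y hy => by rw [hy.2]; trivial)
  choose a ha hat using ha
  let φ := chartAt ℂ x
  let unit (i j : Fin n) : (Fin n → ℂ) →L[ℂ] (Fin n → ℂ) :=
    (ContinuousLinearMap.proj j).smulRight (Pi.single i 1)
  -- If `∇ t_j = ∑ a_{ji} t_i`, then `∑ u_i t_i` is flat exactly when `u_i' = -∑ a_{ji} u_j`; hence
  -- the minus sign and the transposition.
  let A : ℂ → (Fin n → ℂ) →L[ℂ] (Fin n → ℂ) := fun z =>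
    ∑ i, ∑ j, (-(a j i (φ.symm z))) • unit i j
  have hA : AnalyticAt ℂ A (φ x) := by
    refine Finset.analyticAt_fun_sum _ fun i _ => Finset.analyticAt_fun_sum _ fun j _ => ?_
    have := ((holAt_iff_analyticAt (mem_chart_source ℂ x)).1 (ha j i)).neg
    exact this.smul (analyticAt_const (v := unit i j))
  obtain ⟨Y, hY, hY1, hYA⟩ := exists_analyticAt_deriv_eq_mul hA
  let u : ℂ → Fin n → ℂ := fun z => Y z (b.repr v)
  have hYu : ∀ i, ∀ z, AnalyticAt ℂ Y z → AnalyticAt ℂ (fun z => u z i) z := fun i z hz =>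
    ((ContinuousLinearMap.proj (R := ℂ) (φ := fun _ : Fin n => ℂ) i ∘L
      ContinuousLinearMap.apply ℂ (Fin n → ℂ) (b.repr v : Fin n → ℂ)).analyticAt _).comp hz
  have hdu : ∀ i, ∀ z, AnalyticAt ℂ Y z → deriv (fun z => u z i) z = deriv Y z (b.repr v) i :=
    fun i z hz => by
      have := ((ContinuousLinearMap.proj (R := ℂ) (φ := fun _ : Fin n => ℂ) i ∘L
        ContinuousLinearMap.apply ℂ (Fin n → ℂ)
          (b.repr v : Fin n → ℂ)).hasFDerivAt (x := Y z)).comp_hasDerivAt z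
            hz.differentiableAt.hasDerivAt
      exact this.deriv
  refine ⟨fun y => ∑ i, u (φ y) i • t i y, ?_, ?_, ?_⟩
  · exact sum_smul_mem_holGerms
      (fun i _ => holAt_comp_chart (mem_chart_source ℂ x) (hYu i _ hY)) fun i _ => ht i
  · filter_upwards [eventually_mem_chart_source x,
      (tendsto_chartAt x).eventually hY.eventually_analyticAt, (tendsto_chartAt x).eventually hYA,
      eventually_all.2 fun i => eventually_mem_holGerms (ht i), eventually_all.2 hat]
      with y hy hYy hYAy hty haty
    refine connection_eq_zero hy ?_
    rw [nabla, connection_sum_smul D _ (fun i _ => holAt_comp_chart hy (hYu i _ hYy))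
      fun i _ => hty i]
    have h1 : ∀ i, mvfderiv 𝓘(ℂ, ℂ) (fun y => u (chartAt ℂ x y) i) y (dz x y) =
        -∑ j, a j i y * u (chartAt ℂ x y) j := by
      intro i
      rw [mvfderiv_comp_chart (h := fun z => u z i) hy (hYu i _ hYy), hdu i _ hYy, hYAy]
      change (A (φ y)) (u (φ y)) i = _
      have : φ.symm (φ y) = y := φ.left_inv hy
      simp [A, unit, this, Finset.sum_apply, Pi.single_apply, Finset.sum_neg_distrib]
      rfl
    have h2 : ∀ i, D (t i) y (dz x y) = ∑ j, a i j y • t j y := haty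
    simp only [h1, h2, Finset.smul_sum, Finset.sum_add_distrib, neg_smul, Finset.sum_smul,
      Finset.sum_neg_distrib, smul_smul]
    rw [Finset.sum_comm, add_neg_eq_zero]
    exact Finset.sum_congr rfl fun i _ => Finset.sum_congr rfl fun j _ => by rw [mul_comm]
  · change ∑ i, (Y (φ x)) (b.repr v) i • t i x = v
    rw [hY1]
    simp [htx, b.sum_repr]

end Connections

/-! ### The iterates of `Dhat` as spans of successive derivatives. -/

section Derived

variable {X : Type*} [TopologicalSpace X] [ChartedSpace ℂ X] [IsManifold 𝓘(ℂ, ℂ) ω X]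
  {F : Type*} [NormedAddCommGroup F] [NormedSpace ℂ F] [FiniteDimensional ℂ F]
  {E : X → Type*} [TopologicalSpace (TotalSpace F E)]
  [∀ x, AddCommGroup (E x)] [∀ x, Module ℂ (E x)] [∀ x, TopologicalSpace (E x)]
  [∀ x, IsTopologicalAddGroup (E x)] [∀ x, ContinuousSMul ℂ (E x)]
  [FiberBundle F E] [VectorBundle ℂ F E] [ContMDiffVectorBundle ω F E 𝓘(ℂ, ℂ)]

theorem isHolSubbundle_of_frames {V : ∀ x, Submodule ℂ (E x)}
    (h : ∀ x, ∃ (ι : Type) (_ : Fintype ι) (e : ι → Π y, E y), (∀ i, e i ∈ holGerms F x) ∧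
      LinearIndependent ℂ (fun i => e i x) ∧
      ∀ᶠ y in 𝓝 x, V y = Submodule.span ℂ (Set.range fun i => e i y)) :
    IsHolSubbundle F V := by
  intro x
  obtain ⟨ι, _, e, he, hli, hV⟩ := h x
  let q := (Fintype.equivFin ι).symm
  refine ⟨Fintype.card ι, fun i => e (q i), fun i => he _, ?_⟩
  filter_upwards [eventually_linearIndependent he hli, hV] with y hy hy'
  refine ⟨hy.comp _ q.injective, ?_⟩
  rw [hy']
  congr 1
  exact q.surjective.range_comp fun i => e i y

/-- `e` consists of a local frame `e 0` of `V` near `x` together with its derivatives `e j` of order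
`j ≤ N`, all of which are linearly independent. -/
structure IsDerivedFrame (D : CovariantDerivative 𝓘(ℂ, ℂ) F E) (V : ∀ x, Submodule ℂ (E x))
    (N : ℕ) (x : X) (r : ℕ) (e : ℕ → Fin r → Π y, E y) : Prop where
  mem : ∀ j ≤ N, ∀ i, e j i ∈ holGerms F x
  linearIndependent : LinearIndependent ℂ fun p : Fin (N + 1) × Fin r => e p.1 p.2 x
  span_zero : ∀ᶠ y in 𝓝 x, V y = Submodule.span ℂ (Set.range fun i => e 0 i y)
  succ : ∀ j < N, ∀ i, ∀ᶠ y in 𝓝 x, e (j + 1) i y = nabla D x (e j i) y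

/-- The span of the first `k` derivatives of a frame. -/
def derivedSpan {r : ℕ} (e : ℕ → Fin r → Π y, E y) (k : ℕ) (y : X) : Submodule ℂ (E y) :=
  Submodule.span ℂ (Set.range fun p : Fin (k + 1) × Fin r => e p.1 p.2 y)

theorem mem_derivedSpan {r : ℕ} (e : ℕ → Fin r → Π y, E y) {k j : ℕ} (hj : j ≤ k) (i : Fin r)
    (y : X) : e j i y ∈ derivedSpan e k y :=
  Submodule.subset_span ⟨(⟨j, Nat.lt_succ_of_le hj⟩, i), rfl⟩

theorem derivedSpan_le {r : ℕ} {e : ℕ → Fin r → Π y, E y} {k : ℕ} {y : X}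
    {W : Submodule ℂ (E y)} (h : ∀ j ≤ k, ∀ i, e j i y ∈ W) : derivedSpan e k y ≤ W := by
  refine Submodule.span_le.2 ?_
  rintro _ ⟨p, rfl⟩
  exact h _ (Nat.lt_succ_iff.1 p.1.2) _

namespace IsDerivedFrame

variable {D : CovariantDerivative 𝓘(ℂ, ℂ) F E} {V : ∀ x, Submodule ℂ (E x)}
  {N : ℕ} {x : X} {r : ℕ} {e : ℕ → Fin r → Π y, E y}

theorem eventually_mem (h : IsDerivedFrame D V N x r e) :
    ∀ᶠ y in 𝓝 x, ∀ j ≤ N, ∀ i, e j i ∈ holGerms F y :=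
  (Set.finite_le_nat N).eventually_all.2 fun j hj =>
    eventually_all.2 fun i => eventually_mem_holGerms (h.mem j hj i)

theorem eventually_succ (h : IsDerivedFrame D V N x r e) :
    ∀ᶠ y in 𝓝 x, ∀ j < N, ∀ i, e (j + 1) i y = nabla D x (e j i) y :=
  (Set.finite_lt_nat N).eventually_all.2 fun j hj => eventually_all.2 fun i => h.succ j hj i

theorem linearIndependent_of_le (h : IsDerivedFrame D V N x r e) {k : ℕ} (hk : k ≤ N) :
    ∀ᶠ y in 𝓝 x, LinearIndependent ℂ fun p : Fin (k + 1) × Fin r => e p.1 p.2 y := by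
  filter_upwards [eventually_linearIndependent (F := F)
    (e := fun p : Fin (N + 1) × Fin r => e p.1 p.2)
    (fun p => h.mem _ (Nat.lt_succ_iff.1 p.1.2) _) h.linearIndependent] with y hy
  exact hy.comp (Prod.map (Fin.castLE (Nat.succ_le_succ hk)) id)
    ((Fin.castLE_injective _).prodMap Function.injective_id)

end IsDerivedFrame

theorem isHolSubbundle_of_derivedSpan {D : CovariantDerivative 𝓘(ℂ, ℂ) F E}
    {V A : ∀ x, Submodule ℂ (E x)} {N k : ℕ} (hk : k ≤ N)
    (h : ∀ x, ∃ r e, IsDerivedFrame D V N x r e ∧ ∀ᶠ y in 𝓝 x, A y = derivedSpan e k y) :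
    IsHolSubbundle F A := by
  refine isHolSubbundle_of_frames fun x => ?_
  obtain ⟨r, e, he, hA⟩ := h x
  exact ⟨Fin (k + 1) × Fin r, inferInstance, fun p => e p.1 p.2,
    fun p => he.mem _ ((Nat.lt_succ_iff.1 p.1.2).trans hk) _,
    (he.linearIndependent_of_le hk).self_of_nhds, hA⟩

/-- One step of the iteration defining the subbundle generated by `V`. -/
theorem eventually_Dhat_eq {D : CovariantDerivative 𝓘(ℂ, ℂ) F E}
    {V A : ∀ x, Submodule ℂ (E x)} {N k : ℕ} (hk : k < N)
    (hex : ∀ x, ∃ r e, IsDerivedFrame D V N x r e)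
    (hA : ∀ x r e, IsDerivedFrame D V N x r e → ∀ᶠ y in 𝓝 x, A y = derivedSpan e k y)
    {x : X} {r : ℕ} {e : ℕ → Fin r → Π y, E y} (he : IsDerivedFrame D V N x r e) :
    ∀ᶠ y in 𝓝 x, Dhat D A y = derivedSpan e (k + 1) y := by
  -- The candidate is defined without frames, so it makes sense globally and visibly lies in every
  -- competitor; local frames are needed only to show that it is a subbundle.
  let U : ∀ x, Submodule ℂ (E x) := fun y => A y ⊔ Submodule.span ℂ
    {w | ∃ t ∈ holGerms F y, (∀ᶠ z in 𝓝 y, t z ∈ A z) ∧ ∃ v, w = D t y v}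
  have hU : ∀ x r e, IsDerivedFrame D V N x r e →
      ∀ᶠ y in 𝓝 x, U y = derivedSpan e (k + 1) y := by
    intro x r e he
    filter_upwards [(hA x r e he).eventually_nhds, he.eventually_mem, he.eventually_succ,
      he.linearIndependent_of_le hk.le, eventually_mem_chart_source x] with y hAy hmem hsucc hli hy
    refine le_antisymm (sup_le ?_ (Submodule.span_le.2 ?_)) (derivedSpan_le fun j hj i => ?_)
    · rw [hAy.self_of_nhds]
      exact derivedSpan_le fun j hj i => mem_derivedSpan e (hj.trans k.le_succ) i y
    · rintro _ ⟨t, ht, htA, v, rfl⟩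
      -- A section of `A` has holomorphic coefficients in the derivatives of order at most `k`; by
      -- the Leibniz rule its own derivative involves at most order `k + 1`.
      obtain ⟨g, hg, hgt⟩ := exists_holAt_coeff (e := fun p : Fin (k + 1) × Fin r => e p.1 p.2)
        (fun p => hmem _ ((Nat.lt_succ_iff.1 p.1.2).trans hk.le) _) hli ht
        (by filter_upwards [htA, hAy] with z hz hz'; rw [hz'] at hz; exact hz)
      have hmem' : ∀ p : Fin (k + 1) × Fin r, e p.1 p.2 ∈ holGerms F y := fun p =>
        hmem _ ((Nat.lt_succ_iff.1 p.1.2).trans hk.le) _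
      rw [connection_congr D (sum_smul_mem_holGerms (fun p _ => hg p) fun p _ => hmem' p) hgt,
        connection_sum_smul D _ (fun p _ => hg p) fun p _ => hmem' p]
      refine Submodule.sum_mem _ fun p _ => Submodule.add_mem _ (Submodule.smul_mem _ _ ?_)
        (Submodule.smul_mem _ _ (mem_derivedSpan e p.1.2.le _ y))
      obtain ⟨c, rfl⟩ := exists_eq_smul_dz hy v
      rw [map_smul]
      refine Submodule.smul_mem _ _ ?_
      have := hsucc p.1 (lt_of_le_of_lt (Nat.lt_succ_iff.1 p.1.2) hk) p.2
      rw [nabla] at this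
      rw [← this]
      exact mem_derivedSpan e (Nat.succ_le_of_lt p.1.2) _ y
    · rcases Nat.lt_or_ge j (k + 1) with h | h
      · refine Submodule.mem_sup_left ?_
        rw [hAy.self_of_nhds]
        exact mem_derivedSpan e (Nat.lt_succ_iff.1 h) i y
      · obtain rfl : j = k + 1 := le_antisymm hj h
        refine Submodule.mem_sup_right (Submodule.subset_span
          ⟨e k i, hmem k hk.le i, ?_, dz x y, hsucc k hk i⟩)
        filter_upwards [hAy] with z hz
        rw [hz]
        exact mem_derivedSpan e le_rfl i z
  have hD : Dhat D A = U := by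
    refine le_antisymm (sInf_le ⟨?_, fun y => le_sup_left, fun y t ht htA v => ?_⟩)
      (le_sInf fun W hW y => ?_)
    · exact isHolSubbundle_of_derivedSpan hk fun x => by
        obtain ⟨r, e, he⟩ := hex x
        exact ⟨r, e, he, hU x r e he⟩
    · exact Submodule.mem_sup_right (Submodule.subset_span ⟨t, ht, htA, v, rfl⟩)
    · refine sup_le (hW.2.1 y) (Submodule.span_le.2 ?_)
      rintro _ ⟨t, ht, htA, v, rfl⟩
      exact hW.2.2 y t ht htA v
  rw [hD]
  exact hU x r e he

/-- Frames are required at every point, and the induction runs over all of them, because `Dhat`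
tests against global subbundles: one step is understood near a point only if the preceding iterate
is known everywhere. -/
theorem eventually_iterate_Dhat_eq {D : CovariantDerivative 𝓘(ℂ, ℂ) F E}
    {V : ∀ x, Submodule ℂ (E x)} {N : ℕ} (hex : ∀ x, ∃ r e, IsDerivedFrame D V N x r e)
    {k : ℕ} (hk : k ≤ N) {x : X} {r : ℕ} {e : ℕ → Fin r → Π y, E y}
    (he : IsDerivedFrame D V N x r e) :
    ∀ᶠ y in 𝓝 x, (Dhat D)^[k] V y = derivedSpan e k y := by
  induction k generalizing x r e with
  | zero =>
    filter_upwards [he.span_zero] with y hy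
    rw [Function.iterate_zero, id, hy]
    refine le_antisymm (Submodule.span_le.2 ?_) (derivedSpan_le fun j hj i => ?_)
    · rintro _ ⟨i, rfl⟩
      exact mem_derivedSpan e le_rfl i y
    · obtain rfl : j = 0 := Nat.le_zero.1 hj
      exact Submodule.subset_span ⟨i, rfl⟩
  | succ k ih =>
    rw [Function.iterate_succ_apply']
    exact eventually_Dhat_eq hk hex (fun x r e he => ih (Nat.le_of_succ_le hk) he) he

end Derived

/-! ### Derivatives of a frame of `Fil 1` and their Gram matrix. -/

section Frames

variable {X : Type*} [TopologicalSpace X] [ChartedSpace ℂ X] [IsManifold 𝓘(ℂ, ℂ) ω X]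
  {F : Type*} [NormedAddCommGroup F] [NormedSpace ℂ F] [FiniteDimensional ℂ F]
  {E : X → Type*} [TopologicalSpace (TotalSpace F E)]
  [∀ x, AddCommGroup (E x)] [∀ x, Module ℂ (E x)] [∀ x, TopologicalSpace (E x)]
  [∀ x, IsTopologicalAddGroup (E x)] [∀ x, ContinuousSMul ℂ (E x)]
  [FiberBundle F E] [VectorBundle ℂ F E] [ContMDiffVectorBundle ω F E 𝓘(ℂ, ℂ)]
  {m : ℕ} {B : ∀ x, LinearMap.BilinForm ℂ (E x)} {Fil : ℕ → ∀ x, Submodule ℂ (E x)}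
  {D : CovariantDerivative 𝓘(ℂ, ℂ) F E}

/-- The derivatives of a family of sections in the direction of the preferred chart at `x`. -/
def derivedFamily (D : CovariantDerivative 𝓘(ℂ, ℂ) F E) (x : X) {r : ℕ} (s : Fin r → Π y, E y)
    (j : ℕ) (i : Fin r) : Π y, E y :=
  (nabla D x)^[j] (s i)

theorem derivedFamily_succ (x : X) {r : ℕ} (s : Fin r → Π y, E y) (j : ℕ) (i : Fin r) :
    derivedFamily D x s (j + 1) i = nabla D x (derivedFamily D x s j i) :=
  Function.iterate_succ_apply' _ _ _

theorem derivedFamily_mem (hD : IsHolConnection D) {x : X} {r : ℕ} {s : Fin r → Π y, E y}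
    (hs : ∀ i, s i ∈ holGerms F x) (j : ℕ) (i : Fin r) :
    derivedFamily D x s j i ∈ holGerms F x := by
  induction j with
  | zero => exact hs i
  | succ j ih =>
    rw [derivedFamily_succ]
    exact nabla_mem_holGerms hD ih

theorem IsSOFiltration.le (hF : IsSOFiltration (F := F) m B Fil) {i j : ℕ} (hij : i ≤ j)
    (hj : j ≤ 2 * m + 1) : Fil i ≤ Fil j := by
  induction j, hij using Nat.le_induction with
  | base => exact le_rfl
  | succ j _ ih => exact (ih (by omega)).trans (hF.mono j (by omega))

theorem eventually_derivedFamily_mem_fil (hD : IsFilteredConnection m B Fil D) {x : X} {r : ℕ}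
    {s : Fin r → Π y, E y}
    (hs : ∀ i, s i ∈ holGerms F x) (hs1 : ∀ᶠ y in 𝓝 x, ∀ i, s i y ∈ Fil 1 y) {j : ℕ}
    (hj : j ≤ 2 * m) : ∀ᶠ y in 𝓝 x, ∀ i, derivedFamily D x s j i y ∈ Fil (j + 1) y := by
  induction j with
  | zero => exact hs1
  | succ j ih =>
    filter_upwards [(ih (by omega)).eventually_nhds, eventually_all.2 fun i =>
      eventually_mem_holGerms (derivedFamily_mem hD.holomorphic hs j i)] with y hy hy' i
    rw [derivedFamily_succ]
    exact hD.transversal (j + 1) (Finset.mem_Icc.2 ⟨by omega, hj⟩) y _ (hy' i)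
      (hy.mono fun z hz => hz i) _

/-- One downward step in the filtration: if the derivative dies in the target quotient, the class of
the section lies in the kernel of the injective second fundamental form. -/
theorem mem_of_secondFundamentalForm {V₁ V₂ V₃ V₄ : ∀ x, Submodule ℂ (E x)}
    {S : ∀ x, Gr V₁ V₂ x →ₗ[ℂ] TangentSpace 𝓘(ℂ, ℂ) x →ₗ[ℂ] Gr V₃ V₄ x}
    (hS : IsSecondFundamentalForm D V₁ V₂ V₃ V₄ S) {x y : X} (hy : y ∈ (chartAt ℂ x).source)
    (hinj : Function.Injective (S y)) {t : Π y, E y} (ht : t ∈ holGerms F y)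
    (htV : ∀ᶠ z in 𝓝 y, t z ∈ V₂ z) (hD : nabla D x t y ∈ V₃ y) : t y ∈ V₁ y := by
  have h0 : S y (Submodule.Quotient.mk ⟨t y, htV.self_of_nhds⟩) = 0 := by
    refine LinearMap.ext fun v => ?_
    obtain ⟨c, rfl⟩ := exists_eq_smul_dz hy v
    obtain ⟨h, hh⟩ := hS y t ht htV (dz x y)
    rw [map_smul, hh, LinearMap.zero_apply, (Submodule.Quotient.mk_eq_zero _).2, smul_zero]
    exact hD
  have h1 := hinj (h0.trans (map_zero _).symm)
  exact (Submodule.Quotient.mk_eq_zero ((V₁ y).submoduleOf (V₂ y))).1 h1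

/-- The same descent across the middle of the filtration, two steps at once, since only the
composite is assumed bijective there. -/
theorem mem_of_secondFundamentalForm_comp {V₁ V₂ V₃ V₄ V₅ : ∀ x, Submodule ℂ (E x)}
    {S : ∀ x, Gr V₁ V₂ x →ₗ[ℂ] TangentSpace 𝓘(ℂ, ℂ) x →ₗ[ℂ] Gr V₂ V₃ x}
    {S' : ∀ x, Gr V₂ V₃ x →ₗ[ℂ] TangentSpace 𝓘(ℂ, ℂ) x →ₗ[ℂ] Gr V₄ V₅ x}
    (hS : IsSecondFundamentalForm D V₁ V₂ V₂ V₃ S) (hS' : IsSecondFundamentalForm D V₂ V₃ V₄ V₅ S')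
    {x y : X} (hy : y ∈ (chartAt ℂ x).source)
    (hinj : Function.Injective fun u => S' y ∘ₗ S y u) {t : Π y, E y} (ht : t ∈ holGerms F y)
    (ht' : nabla D x t ∈ holGerms F y) (htV : ∀ᶠ z in 𝓝 y, t z ∈ V₂ z)
    (htV' : ∀ᶠ z in 𝓝 y, nabla D x t z ∈ V₃ z)
    (hD : nabla D x (nabla D x t) y ∈ V₄ y) : t y ∈ V₁ y := by
  have h0 : S' y ∘ₗ S y (Submodule.Quotient.mk ⟨t y, htV.self_of_nhds⟩) = 0 := by
    refine LinearMap.ext fun v => LinearMap.ext fun w => ?_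
    obtain ⟨c, rfl⟩ := exists_eq_smul_dz hy v
    obtain ⟨d, rfl⟩ := exists_eq_smul_dz hy w
    obtain ⟨h, hh⟩ := hS y t ht htV (dz x y)
    obtain ⟨h', hh'⟩ := hS' y _ ht' htV' (dz x y)
    rw [LinearMap.comp_apply, map_smul, map_smul, map_smul, hh, LinearMap.smul_apply]
    have : S' y (Submodule.Quotient.mk ⟨D t y (dz x y), h⟩) (dz x y) = 0 :=
      hh'.trans ((Submodule.Quotient.mk_eq_zero _).2 hD)
    rw [this]
    simp
  have h1 : (Submodule.Quotient.mk ⟨t y, htV.self_of_nhds⟩ : Gr V₁ V₂ y) = 0 := by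
    refine hinj (h0.trans ?_)
    simp
  exact (Submodule.Quotient.mk_eq_zero ((V₁ y).submoduleOf (V₂ y))).1 h1

/-- The derivatives of order `k ≠ m` of a frame of `Fil 1` are independent modulo `Fil k`. -/
theorem eq_zero_of_sum_mem_fil (hm : 1 ≤ m) (hF : IsSOFiltration (F := F) m B Fil)
    (hD : IsFilteredConnection m B Fil D) {x y : X} (hy : y ∈ (chartAt ℂ x).source) {r : ℕ}
    {s : Fin r → Π y, E y}
    (hmem : ∀ᶠ z in 𝓝 y, ∀ j ≤ 2 * m, ∀ i, derivedFamily D x s j i ∈ holGerms F z)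
    (hfil : ∀ᶠ z in 𝓝 y, ∀ j ≤ 2 * m, ∀ i, derivedFamily D x s j i z ∈ Fil (j + 1) z)
    (hli : LinearIndependent ℂ fun i => s i y) (c : Fin r → ℂ) {k : ℕ} (hk : k ≤ 2 * m)
    (hkm : k ≠ m) (h : ∑ i, c i • derivedFamily D x s k i y ∈ Fil k y) : c = 0 := by
  -- The coefficients `c` are frozen at `y` and used as constants, so that differentiating the
  -- combination only raises the order `j`.
  let t (j : ℕ) : Π z, E z := fun z => ∑ i, c i • derivedFamily D x s j i z
  have htmem : ∀ᶠ z in 𝓝 y, ∀ j ≤ 2 * m, t j ∈ holGerms F z := by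
    filter_upwards [hmem] with z hz j hj
    exact sum_smul_mem_holGerms (fun i _ => holAt_const (c i) z) fun i _ => hz j hj i
  have htsucc : ∀ᶠ z in 𝓝 y, ∀ j ≤ 2 * m, nabla D x (t j) z = t (j + 1) z := by
    filter_upwards [hmem] with z hz j hj
    have h0 := connection_sum_smul D Finset.univ (fun i _ => holAt_const (c i) z)
      (fun i _ => hz j hj i) (dz x z)
    refine h0.trans (Finset.sum_congr rfl fun i _ => ?_)
    rw [mvfderiv_const, derivedFamily_succ]
    simp [nabla]
  have htfil : ∀ᶠ z in 𝓝 y, ∀ j ≤ 2 * m, t j z ∈ Fil (j + 1) z := by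
    filter_upwards [hfil] with z hz j hj
    exact Submodule.sum_mem _ fun i _ => Submodule.smul_mem _ _ (hz j hj i)
  have hzero : t 0 y ∈ Fil 0 y → c = 0 := fun h0 => by
    rw [hF.zero] at h0
    exact funext (Fintype.linearIndependent_iff.1 hli c h0)
  have hstep : ∀ k, k + 1 ≤ 2 * m → k + 1 ≠ m → k + 1 ≠ m + 1 → t (k + 1) y ∈ Fil (k + 1) y →
      t k y ∈ Fil k y := by
    intro k hk h1 h2 h
    obtain ⟨S, hS, hbij⟩ := hD.iso (k + 1) (Finset.mem_Icc.2 ⟨by omega, hk⟩) h1 h2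
    refine mem_of_secondFundamentalForm hS hy (hbij y).1 (htmem.self_of_nhds k (by omega))
      (htfil.mono fun z hz => hz k (by omega)) ?_
    rwa [htsucc.self_of_nhds k (by omega)]
  -- The forms with indices `m` and `m + 1` are not separately available as isomorphisms, so the
  -- descent jumps from `m + 1` to `m - 1`.
  have hmid : t (m + 1) y ∈ Fil (m + 1) y → t (m - 1) y ∈ Fil (m - 1) y := by
    intro h
    obtain ⟨S, S', hS, hS', hbij⟩ := hD.iso_middle
    obtain ⟨l, rfl⟩ : ∃ l, m = l + 1 := ⟨m - 1, by omega⟩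
    change t l y ∈ Fil l y
    have hn : ∀ᶠ z in 𝓝 y, nabla D x (t l) z = t (l + 1) z :=
      htsucc.mono fun z hz => hz l (by omega)
    have hn' : nabla D x (t l) ∈ holGerms F y :=
      holGerms_congr (htmem.self_of_nhds (l + 1) (by omega)) hn
    refine mem_of_secondFundamentalForm_comp hS hS' hy (hbij y).1
      (htmem.self_of_nhds l (by omega)) hn' (htfil.mono fun z hz => hz l (by omega)) ?_ ?_
    · filter_upwards [hn, htfil] with z hz hz'
      rw [hz]
      exact hz' (l + 1) (by omega)
    -- The inner derivative agrees with `t (l + 1)` only near `y`, so locality of the connection is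
    -- needed before differentiating again.
    · rw [nabla, connection_congr D (htmem.self_of_nhds (l + 1) (by omega)) hn]
      have := htsucc.self_of_nhds (l + 1) (by omega)
      rw [nabla] at this
      rwa [this]
  have hlow : ∀ k < m, t k y ∈ Fil k y → c = 0 := by
    intro k hk
    induction k with
    | zero => exact hzero
    | succ k ih => exact fun h => ih (by omega) (hstep k (by omega) (by omega) (by omega) h)
  have hhigh : ∀ k, m + 1 ≤ k → k ≤ 2 * m → t k y ∈ Fil k y → c = 0 := by
    intro k hk
    induction k, hk using Nat.le_induction with
    | base => exact fun _ h => hlow (m - 1) (by omega) (hmid h)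
    | succ k hk ih =>
      exact fun h2 h => ih (by omega) (hstep k h2 (by omega) (by omega) h)
  rcases Nat.lt_or_gt_of_ne hkm with h1 | h1
  · exact hlow k h1 h
  · exact hhigh k h1 hk h

/-- The properties at `y` of the derivatives `e` of order at most `2 m` of a frame of `Fil 1`. -/
structure IsGramFrameAt (m : ℕ) (B : ∀ x, LinearMap.BilinForm ℂ (E x))
    (Fil : ℕ → ∀ x, Submodule ℂ (E x)) {r : ℕ} (e : ℕ → Fin r → Π y, E y) (y : X) : Prop where
  mem : ∀ j ≤ 2 * m, ∀ i, e j i ∈ holGerms F y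
  fil_one : Fil 1 y = Submodule.span ℂ (Set.range fun i => e 0 i y)
  mem_fil : ∀ v, v ∈ Fil (2 * m) y ↔ ∀ i, B y (e 0 i y) v = 0
  top : ∀ c : Fin r → ℂ, (∀ i, ∑ l, c l * B y (e 0 i y) (e (2 * m) l y) = 0) → c = 0
  gram : ∀ u : Fin (2 * m + 1) × Fin r → ℂ,
    (∀ p : Fin (2 * m + 1) × Fin r, ∑ q, u q * B y (e p.1 p.2 y) (e q.1 q.2 y) = 0) → u = 0

/-- The derivative of the zero function, expanded by compatibility of `D` with the form; this is the
integration by parts that fills the Gram matrix. -/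
theorem eventually_form_succ (hD : IsFilteredConnection m B Fil D) {x : X} {s t : Π y, E y}
    (hs : s ∈ holGerms F x)
    (ht : t ∈ holGerms F x) (h : ∀ᶠ y in 𝓝 x, B y (s y) (t y) = 0) :
    ∀ᶠ y in 𝓝 x, B y (nabla D x s y) (t y) + B y (s y) (nabla D x t y) = 0 := by
  filter_upwards [h.eventually_nhds, eventually_mem_holGerms hs, eventually_mem_holGerms ht]
    with y hy hsy hty
  have h1 := hD.compatible y s hsy t hty (dz x y)
  rw [nabla, nabla, ← h1]
  have h2 : (fun y => B y (s y) (t y)) =ᶠ[𝓝 y] fun _ => (0 : ℂ) := hy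
  rw [mvfderiv_congr h2, mvfderiv_const]
  rfl

/-- For `j = 0` the right-hand section lies in `Fil (2 * m)`, the orthogonal of `Fil 1`.
Differentiating the relation for `(j, k)` and using the one for `(j, k + 1)` gives `(j + 1, k)`. -/
theorem eventually_form_eq_zero (hm : 1 ≤ m)
    (hF : IsSOFiltration (F := F) m B Fil)
    (hD : IsFilteredConnection m B Fil D) {x : X} {r : ℕ} {s : Fin r → Π y, E y}
    (hs : ∀ i, s i ∈ holGerms F x) (hs1 : ∀ᶠ y in 𝓝 x, ∀ i, s i y ∈ Fil 1 y) (j : ℕ) :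
    ∀ k, j + k < 2 * m → ∀ i l, ∀ᶠ y in 𝓝 x,
      B y (derivedFamily D x s j i y) (derivedFamily D x s k l y) = 0 := by
  induction j with
  | zero =>
    intro k hk i l
    filter_upwards [hs1, eventually_derivedFamily_mem_fil hD hs hs1 (j := k) (by omega)]
      with y hy hy'
    have h1 : derivedFamily D x s k l y ∈ Fil (2 * m + 1 - 1) y :=
      hF.le (by omega) (by omega) y (hy' l)
    rw [← hF.perp 1 hm y] at h1
    exact h1 _ (hy i)
  | succ j ih =>
    intro k hk i l
    filter_upwards [ih (k + 1) (by omega) i l, eventually_form_succ hD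
      (derivedFamily_mem hD.holomorphic hs j i) (derivedFamily_mem hD.holomorphic hs k l)
      (ih k (by omega) i l)] with y h1 h2
    rw [derivedFamily_succ] at h1 ⊢
    rwa [h1, add_zero] at h2

/-- Differentiating the vanishing entries just above the antidiagonal shows that moving one
derivative across the form changes only the sign. -/
theorem eventually_form_antidiagonal (hm : 1 ≤ m)
    (hF : IsSOFiltration (F := F) m B Fil)
    (hD : IsFilteredConnection m B Fil D) {x : X} {r : ℕ} {s : Fin r → Π y, E y}
    (hs : ∀ i, s i ∈ holGerms F x) (hs1 : ∀ᶠ y in 𝓝 x, ∀ i, s i y ∈ Fil 1 y) (j : ℕ) :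
    ∀ k, j + k = 2 * m → ∀ i l, ∀ᶠ y in 𝓝 x,
      B y (derivedFamily D x s j i y) (derivedFamily D x s k l y) =
        (-1) ^ j * B y (derivedFamily D x s 0 i y) (derivedFamily D x s (2 * m) l y) := by
  induction j with
  | zero =>
    rintro k hk i l
    obtain rfl : k = 2 * m := by omega
    exact .of_forall fun y => by simp
  | succ j ih =>
    intro k hk i l
    filter_upwards [ih (k + 1) (by omega) i l, eventually_form_succ hD
      (derivedFamily_mem hD.holomorphic hs j i) (derivedFamily_mem hD.holomorphic hs k l)
      (eventually_form_eq_zero hm hF hD hs hs1 j k (by omega) i l)] with y h1 h2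
    rw [pow_succ, mul_neg_one, neg_mul, ← h1, derivedFamily_succ, derivedFamily_succ]
    exact eq_neg_of_add_eq_zero_left h2

theorem eq_zero_of_antitriangular_gram {N r : ℕ} {G : ℕ → ℕ → Fin r → Fin r → ℂ}
    (h0 : ∀ j k, j + k < N → ∀ i l, G j k i l = 0)
    (h1 : ∀ j k, j + k = N → ∀ i l, G j k i l = (-1) ^ j * G 0 N i l)
    (htop : ∀ c : Fin r → ℂ, (∀ i, ∑ l, c l * G 0 N i l = 0) → c = 0)
    (u : Fin (N + 1) × Fin r → ℂ)
    (h : ∀ p : Fin (N + 1) × Fin r, ∑ q, u q * G p.1 q.1 p.2 q.2 = 0) : u = 0 := by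
  -- Row `j` determines block `N - j`: earlier blocks meet zero entries, later ones vanish by
  -- induction, and what remains is the invertible antidiagonal block.
  have key : ∀ j, ∀ hj : j ≤ N, ∀ l, u (⟨N - j, by omega⟩, l) = 0 := by
    intro j
    induction j using Nat.strong_induction_on with
    | _ j ih =>
      intro hj
      refine fun l => congrFun (htop (fun l => u (⟨N - j, by omega⟩, l)) fun i => ?_) l
      have hp := h (⟨j, by omega⟩, i)
      rw [Fintype.sum_prod_type, Finset.sum_eq_single ⟨N - j, by omega⟩] at hp
      · simp only [h1 j (N - j) (by omega)] at hp
        have hp' : (-1 : ℂ) ^ j * ∑ l, u (⟨N - j, by omega⟩, l) * G 0 N i l = 0 := by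
          rw [Finset.mul_sum, ← hp]
          exact Finset.sum_congr rfl fun l _ => by ring
        exact (mul_eq_zero.1 hp').resolve_left (pow_ne_zero _ (by norm_num))
      · intro k _ hk
        refine Finset.sum_eq_zero fun l _ => ?_
        have hk' : (k : ℕ) ≠ N - j := fun h => hk (Fin.ext h)
        rcases Nat.lt_or_gt_of_ne hk' with h2 | h2
        · simp only [h0 j k (by omega), mul_zero]
        · have := ih (N - k) (by omega) (by omega) l
          have hkk : (⟨N - (N - k), by omega⟩ : Fin (N + 1)) = k := Fin.ext (by simp; omega)
          rw [hkk] at this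
          simp [this]
      · simp
  ext ⟨k, l⟩
  have := key (N - k) (by omega) l
  have hkk : (⟨N - (N - k), by omega⟩ : Fin (N + 1)) = k := Fin.ext (by simp; omega)
  rwa [hkk] at this

/-- The finitely many relations of orders at most `2 * m` hold on a common neighbourhood, where the
antitriangular shape makes the whole Gram matrix nondegenerate. -/
theorem exists_gramFrame {n : ℕ} (hm : 1 ≤ m) (h : IsQuasioper n m B Fil D) (x : X) :
    ∃ (r : ℕ) (s : Fin r → Π y, E y), (∀ i, s i ∈ holGerms F x) ∧
      ∀ᶠ y in 𝓝 x, IsGramFrameAt (F := F) m B Fil (derivedFamily D x s) y := by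
  obtain ⟨r, s, hs, hspan⟩ := h.filtration.subbundle 1 (by omega) x
  have hF := h.filtration
  have hD := h.connection
  have hs1 : ∀ᶠ y in 𝓝 x, ∀ i, s i y ∈ Fil 1 y := hspan.mono fun y hy i => by
    rw [← hy.2]
    exact Submodule.subset_span ⟨i, rfl⟩
  refine ⟨r, s, hs, ?_⟩
  have hmem : ∀ᶠ y in 𝓝 x, ∀ j ≤ 2 * m, ∀ i, derivedFamily D x s j i ∈ holGerms F y :=
    (Set.finite_le_nat _).eventually_all.2 fun j _ => eventually_all.2 fun i =>
      eventually_mem_holGerms (derivedFamily_mem hD.holomorphic hs j i)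
  have hfil : ∀ᶠ y in 𝓝 x, ∀ j ≤ 2 * m, ∀ i, derivedFamily D x s j i y ∈ Fil (j + 1) y :=
    (Set.finite_le_nat _).eventually_all.2 fun j hj =>
      eventually_derivedFamily_mem_fil hD hs hs1 hj
  have hfin : {p : ℕ × ℕ | p.1 + p.2 ≤ 2 * m}.Finite :=
    ((Set.finite_le_nat (2 * m)).prod (Set.finite_le_nat (2 * m))).subset fun p hp => by
      simp only [Set.mem_ofPred_eq, Set.mem_prod] at hp ⊢
      omega
  have hzero : ∀ᶠ y in 𝓝 x, ∀ p ∈ {p : ℕ × ℕ | p.1 + p.2 ≤ 2 * m}, p.1 + p.2 < 2 * m → ∀ i l,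
      B y (derivedFamily D x s p.1 i y) (derivedFamily D x s p.2 l y) = 0 :=
    hfin.eventually_all.2 fun p _ => by
      by_cases hp : p.1 + p.2 < 2 * m
      · have := eventually_all.2 fun i => eventually_all.2 fun l =>
          eventually_form_eq_zero hm hF hD hs hs1 p.1 p.2 hp i l
        exact this.mono fun y hy _ => hy
      · exact .of_forall fun y h => absurd h hp
  have hanti : ∀ᶠ y in 𝓝 x, ∀ p ∈ {p : ℕ × ℕ | p.1 + p.2 ≤ 2 * m}, p.1 + p.2 = 2 * m → ∀ i l,
      B y (derivedFamily D x s p.1 i y) (derivedFamily D x s p.2 l y) =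
        (-1) ^ p.1 * B y (derivedFamily D x s 0 i y) (derivedFamily D x s (2 * m) l y) :=
    hfin.eventually_all.2 fun p _ => by
      by_cases hp : p.1 + p.2 = 2 * m
      · have := eventually_all.2 fun i => eventually_all.2 fun l =>
          eventually_form_antidiagonal hm hF hD hs hs1 p.1 p.2 hp i l
        exact this.mono fun y hy _ => hy
      · exact .of_forall fun y h => absurd h hp
  filter_upwards [hspan, hmem.eventually_nhds, hfil.eventually_nhds, hzero, hanti,
    eventually_mem_chart_source x] with y hspany hmemy hfily hzeroy hantiy hy
  have hmem_fil : ∀ v, v ∈ Fil (2 * m) y ↔ ∀ i, B y (s i y) v = 0 := by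
    intro v
    have hp : (B y).orthogonal (Fil 1 y) = Fil (2 * m) y := hF.perp 1 hm y
    rw [← hp, ← hspany.2]
    refine ⟨fun hv i => hv _ (Submodule.subset_span ⟨i, rfl⟩), fun hv w hw => ?_⟩
    have : Submodule.span ℂ (Set.range fun i => s i y) ≤ LinearMap.ker ((B y).flip v) :=
      Submodule.span_le.2 (by rintro _ ⟨i, rfl⟩; exact hv i)
    exact this hw
  -- The condition says that a combination of top derivatives is orthogonal to `Fil 1`, that is,
  -- lies in `Fil (2 * m)`; independence modulo `Fil (2 * m)` then applies.
  have htop : ∀ c : Fin r → ℂ,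
      (∀ i, ∑ l, c l * B y (s i y) (derivedFamily D x s (2 * m) l y) = 0) → c = 0 := by
    intro c hc
    refine eq_zero_of_sum_mem_fil hm hF hD hy hmemy hfily hspany.1 c le_rfl (by omega) ?_
    rw [hmem_fil]
    intro i
    rw [← hc i]
    simp
  refine ⟨hmemy.self_of_nhds, hspany.2.symm, hmem_fil, htop, fun u hu => ?_⟩
  exact eq_zero_of_antitriangular_gram
    (G := fun j k i l => B y (derivedFamily D x s j i y) (derivedFamily D x s k l y))
    (fun j k hjk => hzeroy (j, k) hjk.le hjk) (fun j k hjk => hantiy (j, k) hjk.le hjk) htop u hu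

end Frames

/-! ### Linear coordinates on jet fibres by Taylor coefficients. -/

section Jets

variable {X : Type*} [TopologicalSpace X] [ChartedSpace ℂ X] [IsManifold 𝓘(ℂ, ℂ) ω X]
  {V : X → Type*} [∀ x, AddCommGroup (V x)] [∀ x, Module ℂ (V x)] {Γ : HolGerms V}

theorem tendsto_chartAt_symm {x y : X} (hy : y ∈ (chartAt ℂ x).source) :
    Tendsto (chartAt ℂ x).symm (𝓝 (chartAt ℂ x y)) (𝓝 y) := by
  have := (chartAt ℂ x).continuousAt_symm ((chartAt ℂ x).map_source hy)
  rwa [ContinuousAt, (chartAt ℂ x).left_inv hy] at this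

/-- A finite family of holomorphic functionals `φ` and sections `q` which are dual to each other
near `y`, for a family of vector spaces whose holomorphic sections form a module over the
holomorphic functions. -/
structure IsCoframeAt (Γ : HolGerms V) {ι : Type*} [Fintype ι] (φ : ι → ∀ z, V z →ₗ[ℂ] ℂ)
    (q : ι → Π z, V z) (y : X) : Prop where
  smul_mem : ∀ σ ∈ Γ y, ∀ g, HolAt g y → ∀ τ : Π z, V z, (∀ᶠ z in 𝓝 y, τ z = g z • σ z) → τ ∈ Γ y
  holAt : ∀ σ ∈ Γ y, ∀ i, HolAt (fun z => φ i z (σ z)) y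
  mem : ∀ i, q i ∈ Γ y
  eq_sum : ∀ᶠ z in 𝓝 y, ∀ v : V z, v = ∑ i, φ i z v • q i z

variable {ι : Type*} [Fintype ι] {φ : ι → ∀ z, V z →ₗ[ℂ] ℂ} {q : ι → Π z, V z} {x y : X}

/-- Each of the `k + 1` factors vanishing at `y` is divisible by the local coordinate, so the
product contributes order at least `k + 1`. -/
theorem le_analyticOrderAt_of_mem_vanishing (hy : y ∈ (chartAt ℂ x).source)
    (hφ : IsCoframeAt Γ φ q y) {k : ℕ} {σ : Γ y} (hσ : σ ∈ vanishing Γ k y) (i : ι) :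
    ((k + 1 : ℕ) : ℕ∞) ≤ analyticOrderAt ((fun z => φ i z (σ.1 z)) ∘ (chartAt ℂ x).symm)
      (chartAt ℂ x y) := by
  have han : ∀ σ : Γ y, AnalyticAt ℂ ((fun z => φ i z (σ.1 z)) ∘ (chartAt ℂ x).symm)
      (chartAt ℂ x y) := fun σ => (holAt_iff_analyticAt hy).1 (hφ.holAt _ σ.2 i)
  induction hσ using Submodule.span_induction with
  | mem σ hσ =>
    obtain ⟨h, τ, hh, hστ⟩ := hσ
    have h1 : ∀ l, ∃ g, AnalyticAt ℂ g (chartAt ℂ x y) ∧ ∀ᶠ w in 𝓝 (chartAt ℂ x y),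
        (h l ∘ (chartAt ℂ x).symm) w = (w - chartAt ℂ x y) ^ 1 • g w := by
      intro l
      have hl := (holAt_iff_analyticAt hy).1 (hh l).1
      rw [← natCast_le_analyticOrderAt hl, Nat.cast_one, Order.one_le_iff_ne_zero,
        hl.analyticOrderAt_ne_zero]
      simp [(chartAt ℂ x).left_inv hy, (hh l).2]
    choose g hg hgh using h1
    rw [natCast_le_analyticOrderAt (han σ)]
    refine ⟨fun w => (∏ l, g l w) * (φ i _ (τ.1 ((chartAt ℂ x).symm w))),
      (Finset.analyticAt_fun_prod _ fun l _ => hg l).mul (han τ), ?_⟩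
    filter_upwards [eventually_all.2 hgh] with w hw
    simp only [Function.comp_apply, pow_one, smul_eq_mul] at hw
    simp only [hστ, Function.comp_apply, map_smul, hw, Finset.prod_mul_distrib, smul_eq_mul,
      Finset.prod_const, Finset.card_univ, Fintype.card_fin]
    ring
  | zero =>
    rw [analyticOrderAt_eq_top.2 (.of_forall fun w => by simp)]
    exact le_top
  | add σ τ _ _ h h' =>
    refine (le_min h h').trans (le_trans le_analyticOrderAt_add (le_of_eq ?_))
    congr 1
    ext w
    simp
  | smul c σ _ h =>
    rw [natCast_le_analyticOrderAt (han _)] at h ⊢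
    obtain ⟨g, hg, hg'⟩ := h
    refine ⟨fun w => c * g w, analyticAt_const.mul hg, hg'.mono fun w hw => ?_⟩
    simp only [Function.comp_apply, smul_eq_mul] at hw
    simp only [Submodule.coe_smul, Function.comp_apply, Pi.smul_apply, map_smul, hw, smul_eq_mul]
    ring

/-- A power of the local coordinate is divided out of every component, and the quotients are
reassembled with the dual sections `q`. -/
theorem mem_vanishing_of_le_analyticOrderAt (hy : y ∈ (chartAt ℂ x).source)
    (hφ : IsCoframeAt Γ φ q y) {k : ℕ} {σ : Γ y}
    (h : ∀ i, ((k + 1 : ℕ) : ℕ∞) ≤ analyticOrderAt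
      ((fun z => φ i z (σ.1 z)) ∘ (chartAt ℂ x).symm) (chartAt ℂ x y)) :
    σ ∈ vanishing Γ k y := by
  classical
  have han : ∀ i, AnalyticAt ℂ ((fun z => φ i z (σ.1 z)) ∘ (chartAt ℂ x).symm)
      (chartAt ℂ x y) := fun i => (holAt_iff_analyticAt hy).1 (hφ.holAt _ σ.2 i)
  simp only [natCast_le_analyticOrderAt (han _)] at h
  choose g hg hgh using h
  let ζ : X → ℂ := fun z => chartAt ℂ x z - chartAt ℂ x y
  have hζ : HolAt ζ y := holAt_comp_chart (h := fun w => w - chartAt ℂ x y) hy (by fun_prop)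
  have hζ0 : ζ y = 0 := sub_self _
  let τ : ι → Γ y := fun i => ⟨fun z => g i (chartAt ℂ x z) • q i z,
    hφ.smul_mem _ (hφ.mem i) _ (holAt_comp_chart hy (hg i)) _ (.of_forall fun _ => rfl)⟩
  let ρ₀ : ι → Γ y := fun i => ⟨fun z => (∏ _ : Fin (k + 1), ζ z) • (τ i).1 z,
    hφ.smul_mem _ (τ i).2 _ (HolAt.prod fun _ _ => hζ) _ (.of_forall fun _ => rfl)⟩
  have hρ₀ : ∀ i, ρ₀ i ∈ vanishing Γ k y := fun i =>
    Submodule.subset_span ⟨fun _ => ζ, τ i, fun _ => ⟨hζ, hζ0⟩, rfl⟩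
  -- The reassembly reproduces the section only near `y`; this remainder has zero germ but may be
  -- nonzero far away.
  let ρ : Γ y := σ - ∑ i, ρ₀ i
  have hρz : ∀ᶠ z in 𝓝 y, ρ.1 z = 0 := by
    have hc : Tendsto (chartAt ℂ x) (𝓝 y) (𝓝 (chartAt ℂ x y)) := (chartAt ℂ x).continuousAt hy
    filter_upwards [hφ.eq_sum, (chartAt ℂ x).open_source.mem_nhds hy,
      hc.eventually (eventually_all.2 hgh)] with z hz hzs hzg
    have : ρ.1 z = σ.1 z - ∑ i, (∏ _ : Fin (k + 1), ζ z) • g i (chartAt ℂ x z) • q i z := by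
      simp [ρ, ρ₀, τ, Finset.sum_apply]
    rw [this, sub_eq_zero]
    refine (hz (σ.1 z)).trans (Finset.sum_congr rfl fun i _ => ?_)
    have e : φ i ((chartAt ℂ x).symm (chartAt ℂ x z)) (σ.1 ((chartAt ℂ x).symm (chartAt ℂ x z))) =
        φ i z (σ.1 z) := congrArg (fun z => φ i z (σ.1 z)) ((chartAt ℂ x).left_inv hzs)
    rw [e.symm.trans (hzg i), smul_smul]
    simp [ζ]
  have hρ : ρ ∈ vanishing Γ k y := by
    -- The indicator of the support of the remainder vanishes near `y`, so it is an admissible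
    -- factor, and multiplying by its powers leaves the remainder unchanged.
    let χ : X → ℂ := fun z => if ρ.1 z = 0 then 0 else 1
    refine Submodule.subset_span ⟨fun _ => χ, ρ, fun _ => ⟨?_, ?_⟩, ?_⟩
    · exact (holAt_const 0 y).congr (hρz.mono fun z hz => by simp [χ, hz])
    · simp [χ, hρz.self_of_nhds]
    · ext z
      by_cases hz : ρ.1 z = 0 <;> simp [χ, hz]
  have : σ = ρ + ∑ i, ρ₀ i := (sub_add_cancel _ _).symm
  rw [this]
  exact Submodule.add_mem _ hρ (Submodule.sum_mem _ fun i _ => hρ₀ i)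

/-- The Taylor coefficients of the coordinates of a section are linear coordinates on the fibre of
the jet bundle. -/
theorem exists_jetCoord (hy : y ∈ (chartAt ℂ x).source) (hφ : IsCoframeAt Γ φ q y) (k : ℕ) :
    ∃ C : Fin (k + 1) × ι → JetFiber Γ k y →ₗ[ℂ] ℂ,
      (∀ σ ∈ Γ y, ∀ p, C p (jetAt Γ k y σ) =
        iteratedDeriv p.1 ((fun z => φ p.2 z (σ z)) ∘ (chartAt ℂ x).symm) (chartAt ℂ x y)) ∧
      ∀ J, (∀ p, C p J = 0) → J = 0 := by
  have han : ∀ i, ∀ σ : Γ y, AnalyticAt ℂ ((fun z => φ i z (σ.1 z)) ∘ (chartAt ℂ x).symm)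
      (chartAt ℂ x y) := fun i σ => (holAt_iff_analyticAt hy).1 (hφ.holAt _ σ.2 i)
  let c (p : Fin (k + 1) × ι) : Γ y →ₗ[ℂ] ℂ :=
    { toFun := fun σ => iteratedDeriv p.1 ((fun z => φ p.2 z (σ.1 z)) ∘ (chartAt ℂ x).symm)
        (chartAt ℂ x y)
      map_add' := fun σ τ => by
        rw [← iteratedDeriv_add (han p.2 σ).contDiffAt (han p.2 τ).contDiffAt]
        congr 1
        ext w
        simp
      map_smul' := fun a σ => by
        rw [RingHom.id_apply, ← iteratedDeriv_const_smul_field]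
        congr 1
        ext w
        simp }
  have hc : ∀ p, vanishing Γ k y ≤ LinearMap.ker (c p) := fun p σ hσ =>
    (natCast_le_analyticOrderAt_iff_iteratedDeriv_eq_zero (han p.2 σ)).1
      (le_analyticOrderAt_of_mem_vanishing hy hφ hσ p.2) _ p.1.2
  refine ⟨fun p => (vanishing Γ k y).liftQ (c p) (hc p), fun σ hσ p => ?_, fun J hJ => ?_⟩
  · rw [jetAt, dif_pos hσ]
    rfl
  · obtain ⟨σ, rfl⟩ := Submodule.mkQ_surjective _ J
    refine (Submodule.Quotient.mk_eq_zero _).2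
      (mem_vanishing_of_le_analyticOrderAt hy hφ fun i => ?_)
    exact (natCast_le_analyticOrderAt_iff_iteratedDeriv_eq_zero (han i σ)).2
      fun j hj => hJ (⟨j, hj⟩, i)

end Jets

/-! ### The dual bundle and dual connection, seen through the form. -/

section Dual

theorem t2Space_fiber {X : Type*} [TopologicalSpace X]
    (F : Type*) [NormedAddCommGroup F] [NormedSpace ℂ F]
    {E : X → Type*} [TopologicalSpace (TotalSpace F E)]
    [∀ x, AddCommGroup (E x)] [∀ x, Module ℂ (E x)] [∀ x, TopologicalSpace (E x)]
    [FiberBundle F E] [VectorBundle ℂ F E] (x : X) : T2Space (E x) :=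
  ((trivializationAt F E x).continuousLinearEquivAt ℂ x
    (FiberBundle.mem_baseSet_trivializationAt' x)).symm.toHomeomorph.t2Space

variable {X : Type*} [TopologicalSpace X] [ChartedSpace ℂ X] [IsManifold 𝓘(ℂ, ℂ) ω X]
  {F : Type*} [NormedAddCommGroup F] [NormedSpace ℂ F] [FiniteDimensional ℂ F]
  {E : X → Type*} [TopologicalSpace (TotalSpace F E)]
  [∀ x, AddCommGroup (E x)] [∀ x, Module ℂ (E x)] [∀ x, TopologicalSpace (E x)]
  [∀ x, IsTopologicalAddGroup (E x)] [∀ x, ContinuousSMul ℂ (E x)]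
  [FiberBundle F E] [VectorBundle ℂ F E] [ContMDiffVectorBundle ω F E 𝓘(ℂ, ℂ)]
  {B : ∀ x, LinearMap.BilinForm ℂ (E x)}

/-- A section of the dual bundle is holomorphic if its values on holomorphic sections are. -/
theorem mem_holGerms_dual {φ : Π y, Dual E y} {x : X}
    (h : ∀ t ∈ holGerms F x, HolAt (fun y => (φ y (t y) : ℂ)) x) :
    φ ∈ holGerms (F →L[ℂ] ℂ) (E := Dual E) x := by
  refine (contMDiffAt_hom_bundle _).2 ⟨contMDiffAt_id, ?_⟩
  let b := Module.finBasis ℂ F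
  let T := trivializationAt F E x
  let ℓ : Fin (Module.finrank ℂ F) → F →L[ℂ] ℂ := fun i =>
    LinearMap.toContinuousLinearMap (b.coord i)
  have h1 : ContMDiffAt 𝓘(ℂ, ℂ) 𝓘(ℂ, F →L[ℂ] ℂ) ω
      (fun y => ∑ i, (φ y (T.symmL ℂ y (b i)) : ℂ) • ℓ i) x :=
    contMDiffAt_finsetSum fun i _ =>
      ContMDiffAt.smul (h _ (symmL_mem_holGerms x (b i))) contMDiffAt_const
  have h3 : ∀ y, ContinuousLinearMap.inCoordinates F E ℂ (Trivial X ℂ) x y x y (φ y) =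
      ∑ i, (φ y (T.symmL ℂ y (b i)) : ℂ) • ℓ i := by
    intro y
    refine ContinuousLinearMap.ext fun w => ?_
    have h2 : w = ∑ i, b.coord i w • b i := (b.sum_repr w).symm
    have h4 : ContinuousLinearMap.inCoordinates F E ℂ (Trivial X ℂ) x y x y (φ y) w =
        (φ y (T.symmL ℂ y w) : ℂ) := by
      simp [ContinuousLinearMap.inCoordinates, T]
    rw [h4]
    conv_lhs => rw [h2, map_sum, map_sum]
    simp only [map_smul, sum_apply, smul_apply, smul_eq_mul]
    exact Finset.sum_congr rfl fun i _ => mul_comm _ _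
  exact h1.congr_of_eventuallyEq (.of_forall h3)

variable (F) in
/-- The isomorphism of `E` with its dual bundle given by a bilinear form. -/
def formDual (B : ∀ x, LinearMap.BilinForm ℂ (E x)) (x : X) (v : E x) : Dual E x :=
  have := finiteDimensional_fiber F (E := E) x
  have := t2Space_fiber F (E := E) x
  LinearMap.toContinuousLinearMap (B x v)

theorem formDual_apply (x : X) (v w : E x) : (formDual F B x v w : ℂ) = B x v w := rfl

theorem formDual_mem_holGerms (hB : ∀ x, ∀ s ∈ holGerms F x, ∀ t ∈ holGerms F x,
    HolAt (fun y => B y (s y) (t y)) x) {s : Π y, E y} {x : X} (hs : s ∈ holGerms F x) :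
    (fun y => formDual F B y (s y)) ∈ holGerms (F →L[ℂ] ℂ) (E := Dual E) x :=
  mem_holGerms_dual fun t ht => hB x s hs t ht

/-- Compatible connections correspond to each other under the isomorphism of `E` with its dual. -/
theorem dualConnection_formDual (hB : ∀ x, ∀ s ∈ holGerms F x, ∀ t ∈ holGerms F x,
    HolAt (fun y => B y (s y) (t y)) x) {m : ℕ} {Fil : ℕ → ∀ x, Submodule ℂ (E x)}
    {D : CovariantDerivative 𝓘(ℂ, ℂ) F E} (hD : IsFilteredConnection m B Fil D)
    {s : Π y, E y} {x : X} (hs : s ∈ holGerms F x) (v : TangentSpace 𝓘(ℂ, ℂ) x) :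
    dualConnection D (fun y => formDual F B y (s y)) x v = formDual F B x (D s x v) := by
  refine ContinuousLinearMap.ext fun u => ?_
  obtain ⟨t, ht, rfl⟩ := exists_mem_holGerms F u
  have h1 := dualDerivative_apply D
    (mdifferentiableAt_of_mem_holGerms (formDual_mem_holGerms hB hs))
    (mdifferentiableAt_of_mem_holGerms ht) v
  have h2 := hD.compatible x s hs t ht v
  refine h1.trans ?_
  rw [formDual_apply, formDual_apply]
  simp only [formDual_apply]
  rw [h2, add_sub_cancel_right]

end Dual

/-! ### The jet map in Taylor coordinates. -/

section JetCoordinates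

variable {X : Type*} [TopologicalSpace X] [ChartedSpace ℂ X] [IsManifold 𝓘(ℂ, ℂ) ω X]
  {F : Type*} [NormedAddCommGroup F] [NormedSpace ℂ F] [FiniteDimensional ℂ F]
  {E : X → Type*} [TopologicalSpace (TotalSpace F E)]
  [∀ x, AddCommGroup (E x)] [∀ x, Module ℂ (E x)] [∀ x, TopologicalSpace (E x)]
  [∀ x, IsTopologicalAddGroup (E x)] [∀ x, ContinuousSMul ℂ (E x)]
  [FiberBundle F E] [VectorBundle ℂ F E] [ContMDiffVectorBundle ω F E 𝓘(ℂ, ℂ)]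
  {n m : ℕ} {B : ∀ x, LinearMap.BilinForm ℂ (E x)} {Fil : ℕ → ∀ x, Submodule ℂ (E x)}
  {D : CovariantDerivative 𝓘(ℂ, ℂ) F E}

theorem mkQ_mem_quotGerms {V : ∀ x, Submodule ℂ (E x)} {s : Π y, E y} {x : X}
    (hs : s ∈ holGerms F x) : (fun y => (V y).mkQ (s y)) ∈ quotGerms F V x :=
  ⟨s, hs, .of_forall fun _ => rfl⟩

theorem eventually_mem_quotGerms {V : ∀ x, Submodule ℂ (E x)} {σ : Π y, E y ⧸ V y} {x : X}
    (hσ : σ ∈ quotGerms F V x) : ∀ᶠ y in 𝓝 x, σ ∈ quotGerms F V y := by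
  obtain ⟨s, hs, h⟩ := hσ
  filter_upwards [eventually_mem_holGerms hs, h.eventually_nhds] with y hy hy'
  exact ⟨s, hy, hy'⟩

open Classical in
/-- The functional induced on the quotient by a functional which vanishes on the subspace. -/
def quotForm (V : ∀ x, Submodule ℂ (E x)) (ℓ : ∀ x, E x →ₗ[ℂ] ℂ) (x : X) :
    (E x ⧸ V x) →ₗ[ℂ] ℂ :=
  if h : V x ≤ LinearMap.ker (ℓ x) then (V x).liftQ (ℓ x) h else 0

theorem quotForm_mkQ {V : ∀ x, Submodule ℂ (E x)} {ℓ : ∀ x, E x →ₗ[ℂ] ℂ} {x : X}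
    (h : ∀ v ∈ V x, ℓ x v = 0) (v : E x) : quotForm V ℓ x ((V x).mkQ v) = ℓ x v := by
  rw [quotForm, dif_pos (show V x ≤ LinearMap.ker (ℓ x) from h)]
  rfl

/-- The functionals on `E / Fil (2 m)` given by the frame of `Fil 1`. -/
abbrev frameForm (m : ℕ) (B : ∀ x, LinearMap.BilinForm ℂ (E x))
    (Fil : ℕ → ∀ x, Submodule ℂ (E x)) {r : ℕ} (e : ℕ → Fin r → Π y, E y) (i : Fin r) (z : X) :
    (E z ⧸ Fil (2 * m) z) →ₗ[ℂ] ℂ :=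
  quotForm (Fil (2 * m)) (fun z => B z (e 0 i z)) z

theorem IsGramFrameAt.frameForm_mkQ {r : ℕ} {e : ℕ → Fin r → Π y, E y} {y : X}
    (h : IsGramFrameAt (F := F) m B Fil e y) (i : Fin r) (v : E y) :
    frameForm m B Fil e i y ((Fil (2 * m) y).mkQ v) = B y (e 0 i y) v :=
  quotForm_mkQ (fun v hv => (h.mem_fil v).1 hv i) v

theorem IsGramFrameAt.det_ne_zero {r : ℕ} {e : ℕ → Fin r → Π y, E y} {y : X}
    (h : IsGramFrameAt (F := F) m B Fil e y) :
    (Matrix.of fun i l => B y (e 0 i y) (e (2 * m) l y)).det ≠ 0 := by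
  intro h0
  obtain ⟨c, hc, hc'⟩ := Matrix.exists_mulVec_eq_zero_iff.2 h0
  refine hc (h.top c fun i => ?_)
  have := congrFun hc' i
  simpa [Matrix.mulVec, dotProduct, mul_comm] using this

theorem IsGramFrameAt.gram_det_ne_zero {r : ℕ} {e : ℕ → Fin r → Π y, E y} {y : X}
    (h : IsGramFrameAt (F := F) m B Fil e y) :
    (Matrix.of fun p q : Fin (2 * m + 1) × Fin r =>
      B y (e p.1 p.2 y) (e q.1 q.2 y)).det ≠ 0 := by
  intro h0
  obtain ⟨c, hc, hc'⟩ := Matrix.exists_mulVec_eq_zero_iff.2 h0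
  refine hc (h.gram c fun i => ?_)
  have := congrFun hc' i
  simpa [Matrix.mulVec, dotProduct, mul_comm] using this

theorem IsGramFrameAt.linearIndependent {r : ℕ} {e : ℕ → Fin r → Π y, E y} {y : X}
    (h : IsGramFrameAt (F := F) m B Fil e y) :
    LinearIndependent ℂ fun p : Fin (2 * m + 1) × Fin r => e p.1 p.2 y := by
  rw [Fintype.linearIndependent_iff]
  intro u hu
  refine congrFun (h.gram u fun p => ?_)
  have := congrArg (B y (e p.1 p.2 y)) hu
  simpa using this

/-- The functionals `B(e_0, ·)` descend to the quotient by `Fil (2 * m)`. Their dual sections are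
the classes of the top derivatives, corrected by the inverse of the block `B(e_0, e_{2m})`. -/
theorem exists_isCoframeAt (hB : ∀ x, ∀ s ∈ holGerms F x, ∀ t ∈ holGerms F x,
      HolAt (fun y => B y (s y) (t y)) x) {r : ℕ} {e : ℕ → Fin r → Π y, E y} {y : X}
    (h : ∀ᶠ z in 𝓝 y, IsGramFrameAt (F := F) m B Fil e z) :
    ∃ q, IsCoframeAt (quotGerms F (Fil (2 * m))) (frameForm m B Fil e) q y := by
  have hy := h.self_of_nhds
  let N : X → Matrix (Fin r) (Fin r) ℂ := fun z =>
    Matrix.of fun i l => B z (e 0 i z) (e (2 * m) l z)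
  have hN : ∀ i l, HolAt (fun z => N z i l) y := fun i l =>
    hB y _ (hy.mem 0 (Nat.zero_le _) i) _ (hy.mem _ le_rfl l)
  have hinv : ∀ᶠ z in 𝓝 y, N z * (N z)⁻¹ = 1 := h.mono fun z hz =>
    Matrix.mul_nonsing_inv _ (isUnit_iff_ne_zero.2 hz.det_ne_zero)
  -- Each column of the inverse solves a linear system with a constant right-hand side.
  have hNinv : ∀ l i, HolAt (fun z => (N z)⁻¹ l i) y := fun l i =>
    holAt_of_mulVec_eq (M := N) (u := fun z l => (N z)⁻¹ l i) (c := fun _ => (Pi.single i 1))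
      hN (fun _ => holAt_const _ _) hy.det_ne_zero (hinv.mono fun z hz => by
        ext k
        have := congrFun (congrFun hz k) i
        rw [Matrix.mul_apply, Matrix.one_apply] at this
        simpa [Matrix.mulVec, dotProduct, Pi.single_apply] using this) l
  let t : Fin r → Π z, E z := fun i z => ∑ l, (N z)⁻¹ l i • e (2 * m) l z
  have ht : ∀ i, t i ∈ holGerms F y := fun i =>
    sum_smul_mem_holGerms (fun l _ => hNinv l i) fun l _ => hy.mem _ le_rfl l
  refine ⟨fun i z => (Fil (2 * m) z).mkQ (t i z), ?_, ?_, fun i => mkQ_mem_quotGerms (ht i), ?_⟩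
  · rintro σ ⟨s, hs, hσ⟩ g hg τ hτ
    refine ⟨fun z => g z • s z, smul_mem_holGerms hg hs, ?_⟩
    filter_upwards [hσ, hτ] with z h1 h2
    rw [h2, h1, map_smul]
  · rintro σ ⟨s, hs, hσ⟩ i
    refine (hB y _ (hy.mem 0 (Nat.zero_le _) i) s hs).congr ?_
    filter_upwards [hσ, h] with z h1 h2
    rw [h1, h2.frameForm_mkQ]
  · filter_upwards [h, hinv] with z hz hzinv v
    obtain ⟨w, rfl⟩ := Submodule.mkQ_surjective _ v
    simp only [hz.frameForm_mkQ, ← map_smul, ← map_sum]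
    refine (Submodule.Quotient.eq _).2 ((hz.mem_fil _).2 fun k => ?_)
    rw [map_sub, sub_eq_zero]
    have h1 : ∀ i, B z (e 0 k z) (t i z) = (1 : Matrix (Fin r) (Fin r) ℂ) k i := fun i => by
      rw [← hzinv, Matrix.mul_apply]
      simp [t, N, mul_comm]
    simp [h1, Matrix.one_apply]

/-- For flat `w`, compatibility reduces `d B(e_j, w)` to `B(∇ e_j, w)`, so every derivative of the
function falls on the frame. -/
theorem eventually_iteratedDeriv_form (hD : IsFilteredConnection m B Fil D) {N : ℕ} {x y : X}
    (hy : y ∈ (chartAt ℂ x).source) {r : ℕ} {s : Fin r → Π y, E y}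
    (hmem : ∀ᶠ z in 𝓝 y, ∀ j ≤ N, ∀ i, derivedFamily D x s j i ∈ holGerms F z) {w : Π y, E y}
    (hB : ∀ x, ∀ s ∈ holGerms F x, ∀ t ∈ holGerms F x, HolAt (fun y => B y (s y) (t y)) x)
    (hw : w ∈ holGerms F y) (hflat : ∀ᶠ z in 𝓝 y, D w z = 0) {j : ℕ} (hj : j ≤ N) (i : Fin r) :
    ∀ᶠ z in 𝓝 y, iteratedDeriv j
      ((fun z => B z (derivedFamily D x s 0 i z) (w z)) ∘ (chartAt ℂ x).symm) (chartAt ℂ x z) =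
        B z (derivedFamily D x s j i z) (w z) := by
  induction j with
  | zero =>
    filter_upwards [(chartAt ℂ x).open_source.mem_nhds hy] with z hz
    rw [iteratedDeriv_zero]
    exact congrArg (fun z => B z (derivedFamily D x s 0 i z) (w z)) ((chartAt ℂ x).left_inv hz)
  | succ j ih =>
    filter_upwards [(ih (by omega)).eventually_nhds, (chartAt ℂ x).open_source.mem_nhds hy, hmem,
      eventually_mem_holGerms hw, hflat] with z hz hzs hzm hzw hzf
    have h1 : iteratedDeriv j
        ((fun z => B z (derivedFamily D x s 0 i z) (w z)) ∘ (chartAt ℂ x).symm)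
          =ᶠ[𝓝 (chartAt ℂ x z)]
            (fun z => B z (derivedFamily D x s j i z) (w z)) ∘ (chartAt ℂ x).symm := by
      filter_upwards [(tendsto_chartAt_symm hzs).eventually hz,
        (chartAt ℂ x).open_target.mem_nhds ((chartAt ℂ x).map_source hzs)] with a ha hat
      rwa [(chartAt ℂ x).right_inv hat] at ha
    rw [iteratedDeriv_succ, h1.deriv_eq,
      ← mvfderiv_dz hzs (hB z _ (hzm j (by omega) i) w hzw).mdifferentiableAt,
      hD.compatible z _ (hzm j (by omega) i) w hzw, hzf, derivedFamily_succ]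
    simp [nabla]

/-- Near every point the derivatives of a frame of `Fil 1` give coordinates on the jet bundle of
`E / Fil (2 m)`. -/
theorem exists_gramFrame_jetCoord (hm : 1 ≤ m) (h : IsQuasioper n m B Fil D) (x : X) :
    ∃ (r : ℕ) (s : Fin r → Π y, E y)
      (C : ∀ y, Fin (2 * m + 1) × Fin r →
        JetFiber (quotGerms F (Fil (2 * m))) (2 * m) y →ₗ[ℂ] ℂ),
      (∀ i, s i ∈ holGerms F x) ∧
      (∀ ρ ∈ jetGerms (quotGerms F (Fil (2 * m))) (2 * m) x, ∀ p,
        HolAt (fun y => C y p (ρ y)) x) ∧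
      ∀ᶠ y in 𝓝 x, IsGramFrameAt (F := F) m B Fil (derivedFamily D x s) y ∧
        (∀ J, (∀ p, C y p J = 0) → J = 0) ∧
        ∀ v w, IsFlatThrough D y v w → ∀ p,
          C y p (jetAt (quotGerms F (Fil (2 * m))) (2 * m) y fun z => (Fil (2 * m) z).mkQ (w z)) =
            B y (derivedFamily D x s p.1 p.2 y) v := by
  classical
  obtain ⟨r, s, hs, hgram⟩ := exists_gramFrame hm h x
  have hB := h.bundle.holomorphic
  let P (y : X) (C : Fin (2 * m + 1) × Fin r →
      JetFiber (quotGerms F (Fil (2 * m))) (2 * m) y →ₗ[ℂ] ℂ) : Prop :=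
    (∀ σ ∈ quotGerms F (Fil (2 * m)) y, ∀ p,
      C p (jetAt (quotGerms F (Fil (2 * m))) (2 * m) y σ) = iteratedDeriv p.1
        ((fun z => frameForm m B Fil (derivedFamily D x s) p.2 z (σ z)) ∘ (chartAt ℂ x).symm)
          (chartAt ℂ x y)) ∧
      ∀ J, (∀ p, C p J = 0) → J = 0
  -- The coordinates exist only near `x`; elsewhere the value `0` is a default.
  have hC : ∀ y, ∃ C, (∃ C, P y C) → P y C := fun y => by
    by_cases hy : ∃ C, P y C
    · exact ⟨hy.choose, fun _ => hy.choose_spec⟩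
    · exact ⟨0, fun h => absurd h hy⟩
  choose C hC using hC
  have hP : ∀ᶠ y in 𝓝 x, P y (C y) := by
    filter_upwards [hgram.eventually_nhds, eventually_mem_chart_source x] with y hy hys
    obtain ⟨q, hq⟩ := exists_isCoframeAt hB hy
    exact hC y (exists_jetCoord hys hq (2 * m))
  refine ⟨r, s, C, hs, fun ρ hρ p => ?_, ?_⟩
  · obtain ⟨q, hq⟩ := exists_isCoframeAt hB hgram
    induction hρ using Submodule.span_induction with
    | mem ρ hρ =>
      obtain ⟨g, τ, hg, hτ, hρ⟩ := hρ
      -- On a prolongation the coordinate is an iterated derivative of a holomorphic function, taken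
      -- at the moving point, hence holomorphic.
      have han : AnalyticAt ℂ (iteratedDeriv p.1 ((fun z =>
          frameForm m B Fil (derivedFamily D x s) p.2 z (τ z)) ∘ (chartAt ℂ x).symm))
          (chartAt ℂ x x) := by
        rw [iteratedDeriv_eq_iterate]
        exact AnalyticAt.iterated_deriv ((holAt_iff_analyticAt (mem_chart_source ℂ x)).1
          (hq.holAt τ hτ p.2)) p.1
      refine (hg.mul (holAt_comp_chart (mem_chart_source ℂ x) han)).congr ?_
      filter_upwards [hρ, hP, eventually_mem_quotGerms hτ] with y h1 h2 h3
      rw [h1, map_smul, h2.1 τ h3, smul_eq_mul]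
    | zero => exact (holAt_const 0 x).congr (.of_forall fun y => map_zero _)
    | add ρ ρ' _ _ ih ih' =>
      exact HolAt.congr (ContMDiffAt.add ih ih') (.of_forall fun y => map_add _ _ _)
    | smul c ρ _ ih =>
      exact HolAt.congr ((holAt_const c x).mul ih)
        (.of_forall fun y => map_smul (C y p) c (ρ y))
  · filter_upwards [hgram.eventually_nhds, eventually_mem_chart_source x, hP] with y hy hys hPy
    refine ⟨hy.self_of_nhds, hPy.2, fun v w hw p => ?_⟩
    rw [hPy.1 _ (mkQ_mem_quotGerms hw.1), ← hw.2.2]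
    have h1 := (eventually_iteratedDeriv_form h.connection (N := 2 * m) hys
      (hy.mono fun z hz => hz.mem) hB hw.1 hw.2.1 (Nat.lt_succ_iff.1 p.1.2) p.2).self_of_nhds
    rw [← h1]
    refine EventuallyEq.iteratedDeriv_eq _ ?_
    filter_upwards [(tendsto_chartAt_symm hys).eventually hy] with a ha
    exact ha.frameForm_mkQ p.2 _

end JetCoordinates

/-! ### The subbundles `𝔽`, `𝔾` and `𝒮` in terms of the Gram frame. -/

section Main

variable {X : Type*} [TopologicalSpace X] [ChartedSpace ℂ X] [IsManifold 𝓘(ℂ, ℂ) ω X]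
  {F : Type*} [NormedAddCommGroup F] [NormedSpace ℂ F] [FiniteDimensional ℂ F]
  {E : X → Type*} [TopologicalSpace (TotalSpace F E)]
  [∀ x, AddCommGroup (E x)] [∀ x, Module ℂ (E x)] [∀ x, TopologicalSpace (E x)]
  [∀ x, IsTopologicalAddGroup (E x)] [∀ x, ContinuousSMul ℂ (E x)]
  [FiberBundle F E] [VectorBundle ℂ F E] [ContMDiffVectorBundle ω F E 𝓘(ℂ, ℂ)]
  {n m : ℕ} {B : ∀ x, LinearMap.BilinForm ℂ (E x)} {Fil : ℕ → ∀ x, Submodule ℂ (E x)}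
  {D : CovariantDerivative 𝓘(ℂ, ℂ) F E}

theorem isDerivedFrame_of_gramFrame {x : X} {r : ℕ} {s : Fin r → Π y, E y}
    (hs : ∀ᶠ y in 𝓝 x, IsGramFrameAt (F := F) m B Fil (derivedFamily D x s) y) :
    IsDerivedFrame D (Fil 1) (2 * m) x r (derivedFamily D x s) where
  mem := hs.self_of_nhds.mem
  linearIndependent := hs.self_of_nhds.linearIndependent
  span_zero := hs.mono fun _ hy => hy.fil_one
  succ j _ i := .of_forall fun _ => by rw [derivedFamily_succ]

theorem eventually_subF_eq (hm : 1 ≤ m) (h : IsQuasioper n m B Fil D) {x : X} {r : ℕ}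
    {s : Fin r → Π y, E y}
    (hs : ∀ᶠ y in 𝓝 x, IsGramFrameAt (F := F) m B Fil (derivedFamily D x s) y) :
    ∀ᶠ y in 𝓝 x, subF m Fil D y = derivedSpan (derivedFamily D x s) (2 * m) y :=
  eventually_iterate_Dhat_eq (fun x => by
    obtain ⟨r, s, _, hs⟩ := exists_gramFrame hm h x
    exact ⟨r, _, isDerivedFrame_of_gramFrame hs⟩) le_rfl (isDerivedFrame_of_gramFrame hs)

theorem isHolSubbundle_subF (hm : 1 ≤ m) (h : IsQuasioper n m B Fil D) :
    IsHolSubbundle F (subF m Fil D) :=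
  isHolSubbundle_of_derivedSpan (V := Fil 1) le_rfl fun x => by
    obtain ⟨r, s, _, hs⟩ := exists_gramFrame hm h x
    exact ⟨r, _, isDerivedFrame_of_gramFrame hs, eventually_subF_eq hm h hs⟩

variable (F) in
/-- The isomorphism of `E` with its dual bundle given by a bilinear form, as a linear map. -/
def formDualLinear (B : ∀ x, LinearMap.BilinForm ℂ (E x)) (x : X) : E x →ₗ[ℂ] Dual E x where
  toFun := formDual F B x
  map_add' v w := by
    refine ContinuousLinearMap.ext fun u => ?_
    change B x (v + w) u = B x v u + B x w u
    rw [map_add, LinearMap.add_apply]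
  map_smul' c v := by
    refine ContinuousLinearMap.ext fun u => ?_
    change B x (c • v) u = c * B x v u
    rw [map_smul, LinearMap.smul_apply, smul_eq_mul]

theorem formDualLinear_injective (h : IsQuasioper n m B Fil D) (x : X) :
    Function.Injective (formDualLinear F B x) := by
  rw [← LinearMap.ker_eq_bot, LinearMap.ker_eq_bot']
  intro v hv
  refine (h.bundle.nondegenerate x).1 v fun w => ?_
  exact congrArg (fun φ : Dual E x => (φ w : ℂ)) hv

theorem exists_formDual_eq (h : IsQuasioper n m B Fil D) {x : X} (φ : Dual E x) :
    ∃ v, formDual F B x v = φ := by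
  have := finiteDimensional_fiber F (E := E) x
  let φ' : Module.Dual ℂ (E x) := φ.toLinearMap
  refine ⟨((B x).toDual (h.bundle.nondegenerate x)).symm φ', ContinuousLinearMap.ext fun w => ?_⟩
  exact LinearMap.BilinForm.apply_toDual_symm_apply (hB := h.bundle.nondegenerate x) φ' w

/-- A functional killing `Fil (2 * m)`, the orthogonal of `Fil 1`, is represented by a vector of the
double orthogonal of `Fil 1`, which is `Fil 1` by nondegeneracy. -/
theorem dualAnnihilator_eq (hm : 1 ≤ m) (h : IsQuasioper n m B Fil D) {y : X} :
    dualAnnihilator (Fil (2 * m)) y = (Fil 1 y).map (formDualLinear F B y) := by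
  have := finiteDimensional_fiber F (E := E) y
  have hp : (B y).orthogonal (Fil 1 y) = Fil (2 * m) y := h.filtration.perp 1 hm y
  ext φ
  constructor
  · intro hφ
    obtain ⟨v, rfl⟩ := exists_formDual_eq (F := F) h φ
    refine ⟨v, ?_, rfl⟩
    have hv : v ∈ (B y).orthogonal ((B y).orthogonal (Fil 1 y)) := by
      rw [hp]
      intro w hw
      exact ((h.bundle.symm y).eq v w).symm.trans (hφ w hw)
    rwa [LinearMap.BilinForm.orthogonal_orthogonal (h.bundle.nondegenerate y)
      (h.bundle.symm y).isRefl] at hv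
  · rintro ⟨v, hv, rfl⟩ w hw
    rw [← hp] at hw
    exact hw v hv

/-- The form intertwines `D` with its dual, so it transports the frame of derivatives; the
description of the iterates of `Dhat` then applies to `𝔾` as well. -/
theorem isDerivedFrame_dual (hm : 1 ≤ m) (h : IsQuasioper n m B Fil D) {x : X} {r : ℕ}
    {s : Fin r → Π y, E y}
    (hs : ∀ᶠ y in 𝓝 x, IsGramFrameAt (F := F) m B Fil (derivedFamily D x s) y) :
    IsDerivedFrame (dualConnection D) (dualAnnihilator (Fil (2 * m))) (2 * m) x r
      fun j i y => formDual F B y (derivedFamily D x s j i y) where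
  mem j hj i := formDual_mem_holGerms h.bundle.holomorphic (hs.self_of_nhds.mem j hj i)
  linearIndependent := hs.self_of_nhds.linearIndependent.map' (formDualLinear F B x)
    (LinearMap.ker_eq_bot.2 (formDualLinear_injective h x))
  span_zero := hs.mono fun y hy => by
    rw [dualAnnihilator_eq hm h, hy.fil_one, Submodule.map_span, ← Set.range_comp]
    rfl
  succ j hj i := hs.mono fun y hy => by
    rw [derivedFamily_succ]
    exact (dualConnection_formDual h.bundle.holomorphic h.connection (hy.mem j hj.le i) _).symm

/-- Since `𝔾` is the image of `𝔽` under the form, its common zeros are the vectors orthogonal to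
`𝔽`. -/
theorem eventually_mem_subS_iff (hm : 1 ≤ m) (h : IsQuasioper n m B Fil D) {x : X} {r : ℕ}
    {s : Fin r → Π y, E y}
    (hs : ∀ᶠ y in 𝓝 x, IsGramFrameAt (F := F) m B Fil (derivedFamily D x s) y) :
    ∀ᶠ y in 𝓝 x, ∀ v, v ∈ subS m Fil D y ↔
      ∀ p : Fin (2 * m + 1) × Fin r, B y (derivedFamily D x s p.1 p.2 y) v = 0 := by
  have hG := eventually_iterate_Dhat_eq (fun x => by
    obtain ⟨r, s, _, hs⟩ := exists_gramFrame hm h x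
    exact ⟨r, _, isDerivedFrame_dual hm h hs⟩) le_rfl (isDerivedFrame_dual hm h hs)
  filter_upwards [hG] with y hy v
  have hy' : subG m Fil D y = derivedSpan (E := Dual E)
    (fun j i y => formDual F B y (derivedFamily D x s j i y)) (2 * m) y := hy
  constructor
  · intro hv p
    refine hv (formDual F B y (derivedFamily D x s p.1 p.2 y)) ?_
    rw [hy']
    exact mem_derivedSpan _ (Nat.lt_succ_iff.1 p.1.2) p.2 y
  · intro hv φ hφ
    rw [hy'] at hφ
    induction hφ using Submodule.span_induction with
    | mem φ hφ =>
      obtain ⟨p, rfl⟩ := hφ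
      exact hv p
    | zero => rfl
    | add φ ψ _ _ h1 h2 =>
      change (φ v : ℂ) + (ψ v : ℂ) = 0
      rw [h1, h2, add_zero]
    | smul c φ _ h1 =>
      change c * (φ v : ℂ) = 0
      rw [h1, mul_zero]

end Main

section Jets

variable {X : Type*} [TopologicalSpace X] [ChartedSpace ℂ X]
  {V : X → Type*} [∀ x, AddCommGroup (V x)] [∀ x, Module ℂ (V x)] {Γ : HolGerms V} {k : ℕ} {x : X}

theorem mem_jetGerms_of_eventually_eq_zero {ρ : Π y, JetFiber Γ k y} (h : ∀ᶠ y in 𝓝 x, ρ y = 0) :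
    ρ ∈ jetGerms Γ k x :=
  Submodule.subset_span ⟨fun _ => 0, 0, holAt_const 0 x, (Γ x).zero_mem, h.mono fun y hy => by
    rw [hy, zero_smul]⟩

theorem jetGerms_congr {ρ ρ' : Π y, JetFiber Γ k y} (hρ : ρ ∈ jetGerms Γ k x)
    (h : ∀ᶠ y in 𝓝 x, ρ' y = ρ y) : ρ' ∈ jetGerms Γ k x := by
  rw [← add_sub_cancel ρ ρ']
  exact Submodule.add_mem _ hρ (mem_jetGerms_of_eventually_eq_zero
    (h.mono fun y hy => sub_eq_zero.2 hy))

theorem sum_smul_jetAt_mem_jetGerms {ι : Type*} [Fintype ι] {g : ι → X → ℂ} {τ : ι → Π y, V y}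
    (hg : ∀ i, HolAt (g i) x) (hτ : ∀ i, τ i ∈ Γ x) :
    (fun y => ∑ i, g i y • jetAt Γ k y (τ i)) ∈ jetGerms Γ k x := by
  have : (fun y => ∑ i, g i y • jetAt Γ k y (τ i)) = ∑ i, fun y => g i y • jetAt Γ k y (τ i) := by
    ext y
    rw [Finset.sum_apply]
  rw [this]
  exact Submodule.sum_mem _ fun i _ => Submodule.subset_span
    ⟨g i, τ i, hg i, hτ i, .of_forall fun _ => rfl⟩

end Jets

/-! ### Existence, holomorphy, isomorphism and kernel of the jet map. -/

section FlatJetMap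

variable {X : Type*} [TopologicalSpace X] [ChartedSpace ℂ X] [IsManifold 𝓘(ℂ, ℂ) ω X]
  {F : Type*} [NormedAddCommGroup F] [NormedSpace ℂ F] [FiniteDimensional ℂ F]
  {E : X → Type*} [TopologicalSpace (TotalSpace F E)]
  [∀ x, AddCommGroup (E x)] [∀ x, Module ℂ (E x)] [∀ x, TopologicalSpace (E x)]
  [∀ x, IsTopologicalAddGroup (E x)] [∀ x, ContinuousSMul ℂ (E x)]
  [FiberBundle F E] [VectorBundle ℂ F E] [ContMDiffVectorBundle ω F E 𝓘(ℂ, ℂ)]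
  {n m : ℕ} {B : ∀ x, LinearMap.BilinForm ℂ (E x)} {Fil : ℕ → ∀ x, Submodule ℂ (E x)}
  {D : CovariantDerivative 𝓘(ℂ, ℂ) F E}

/-- The separating coordinates of the jet of a flat section through `v` are `B(e_p, v)`: they are
linear in `v` and do not depend on the section. Linearity and well-definedness follow without
uniqueness of flat sections. -/
theorem exists_isFlatJetMap (hm : 1 ≤ m) (h : IsQuasioper n m B Fil D) :
    ∃ f, IsFlatJetMap D (Fil (2 * m)) (2 * m) f := by
  have hx : ∀ x, ∃ f : E x →ₗ[ℂ] JetFiber (quotGerms F (Fil (2 * m))) (2 * m) x,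
      ∀ v s, IsFlatThrough D x v s →
        f v = jetAt (quotGerms F (Fil (2 * m))) (2 * m) x fun y => (Fil (2 * m) y).mkQ (s y) := by
    intro x
    have := finiteDimensional_fiber F (E := E) x
    obtain ⟨r, e, C, -, -, hC⟩ := exists_gramFrame_jetCoord hm h x
    obtain ⟨-, hsep, hval⟩ := hC.self_of_nhds
    choose w hw using exists_isFlatThrough h.connection.holomorphic x
    let b := Module.finBasis ℂ (E x)
    refine ⟨b.constr ℂ fun i => jetAt (quotGerms F (Fil (2 * m))) (2 * m) x
      fun y => (Fil (2 * m) y).mkQ (w (b i) y), fun v s hs => sub_eq_zero.1 (hsep _ fun p => ?_)⟩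
    have hv := congrArg (B x (derivedFamily D x e p.1 p.2 x)) (b.sum_equivFun v)
    rw [map_sum] at hv
    rw [map_sub, hval v s hs, b.constr_apply_fintype (S := ℂ), map_sum]
    simp only [map_smul, hval _ _ (hw _)] at hv ⊢
    rw [hv, sub_self]
  choose f hf using hx
  exact ⟨f, fun x v => ⟨exists_isFlatThrough h.connection.holomorphic x v, hf x v⟩⟩

/-- In a frame of flat sections the coefficients are holomorphic, and at each nearby point `f` takes
a flat frame section to its own prolongation. -/
theorem IsFlatJetMap.isHolHom {V : ∀ x, Submodule ℂ (E x)} {k : ℕ}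
    {f : ∀ x, E x →ₗ[ℂ] JetFiber (quotGerms F V) k x} (hf : IsFlatJetMap D V k f) :
    IsHolHom (holGerms F) (jetGerms (quotGerms F V) k) f := by
  intro x σ hσ
  have := finiteDimensional_fiber F (E := E) x
  let b := Module.finBasis ℂ (E x)
  choose w hw using fun i => (hf x (b i)).1
  have hspan := eventually_span_eq_top b (fun i => (hw i).1) fun i => (hw i).2.2
  obtain ⟨u, hu, hσu⟩ := exists_holAt_coeff (fun i => (hw i).1) hspan.self_of_nhds.1 hσ
    (hspan.mono fun y hy => by rw [hy.2]; trivial)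
  refine jetGerms_congr (sum_smul_jetAt_mem_jetGerms hu fun i =>
    mkQ_mem_quotGerms (V := V) (hw i).1) ?_
  filter_upwards [hσu, eventually_all.2 fun i => eventually_mem_holGerms (hw i).1,
    eventually_all.2 fun i => (hw i).2.1.eventually_nhds] with y h1 h2 h3
  rw [h1, map_sum]
  exact Finset.sum_congr rfl fun i _ => by
    rw [map_smul, (hf y (w i y)).2 (w i) ⟨h2 i, h3 i, rfl⟩]

theorem IsFlatJetMap.exists_gramFrame_jetCoord {f : ∀ x, E x →ₗ[ℂ] _} (hm : 1 ≤ m)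
    (h : IsQuasioper n m B Fil D) (hf : IsFlatJetMap D (Fil (2 * m)) (2 * m) f) (x : X) :
    ∃ (r : ℕ) (s : Fin r → Π y, E y)
      (C : ∀ y, Fin (2 * m + 1) × Fin r →
        JetFiber (quotGerms F (Fil (2 * m))) (2 * m) y →ₗ[ℂ] ℂ),
      (∀ ρ ∈ jetGerms (quotGerms F (Fil (2 * m))) (2 * m) x, ∀ p,
        HolAt (fun y => C y p (ρ y)) x) ∧
      ∀ᶠ y in 𝓝 x, IsGramFrameAt (F := F) m B Fil (derivedFamily D x s) y ∧
        (∀ J, (∀ p, C y p J = 0) → J = 0) ∧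
        ∀ v p, C y p (f y v) = B y (derivedFamily D x s p.1 p.2 y) v := by
  obtain ⟨r, s, C, -, hC, hs⟩ := Quasioper.exists_gramFrame_jetCoord hm h x
  refine ⟨r, s, C, hC, hs.mono fun y hy => ⟨hy.1, hy.2.1, fun v p => ?_⟩⟩
  obtain ⟨w, hw⟩ := (hf y v).1
  rw [(hf y v).2 w hw, hy.2.2 v w hw]

variable {r : ℕ} {e : ℕ → Fin r → Π y, E y} {y : X}

/-- The Gram matrix of a family of sections. -/
abbrev gramMatrix (m : ℕ) (B : ∀ x, LinearMap.BilinForm ℂ (E x)) (e : ℕ → Fin r → Π y, E y)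
    (y : X) : Matrix (Fin (2 * m + 1) × Fin r) (Fin (2 * m + 1) × Fin r) ℂ :=
  Matrix.of fun p q => B y (e p.1 p.2 y) (e q.1 q.2 y)

theorem form_sum (u : Fin (2 * m + 1) × Fin r → ℂ) (p : Fin (2 * m + 1) × Fin r) :
    B y (e p.1 p.2 y) (∑ q : Fin (2 * m + 1) × Fin r, u q • e q.1 q.2 y) =
      (gramMatrix m B e y).mulVec u p := by
  simp [Matrix.mulVec, dotProduct, mul_comm]

theorem IsGramFrameAt.mulVec_inv (h : IsGramFrameAt (F := F) m B Fil e y)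
    (c : Fin (2 * m + 1) × Fin r → ℂ) :
    (gramMatrix m B e y).mulVec ((gramMatrix m B e y)⁻¹.mulVec c) = c := by
  rw [Matrix.mulVec_mulVec, Matrix.mul_nonsing_inv _ (isUnit_iff_ne_zero.2 h.gram_det_ne_zero),
    Matrix.one_mulVec]

theorem IsGramFrameAt.eq_zero (h : IsGramFrameAt (F := F) m B Fil e y)
    {u : Fin (2 * m + 1) × Fin r → ℂ} (hu : ∀ p : Fin (2 * m + 1) × Fin r,
      B y (e p.1 p.2 y) (∑ q : Fin (2 * m + 1) × Fin r, u q • e q.1 q.2 y) = 0) : u = 0 :=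
  h.gram u fun p => by simpa using hu p

theorem IsGramFrameAt.holAt_of_mulVec_eq (hB : ∀ x, ∀ s ∈ holGerms F x, ∀ t ∈ holGerms F x,
      HolAt (fun y => B y (s y) (t y)) x) (h : IsGramFrameAt (F := F) m B Fil e y)
    {u c : X → Fin (2 * m + 1) × Fin r → ℂ} (hc : ∀ p, HolAt (fun z => c z p) y)
    (huc : ∀ᶠ z in 𝓝 y, (gramMatrix m B e z).mulVec (u z) = c z)
    (p : Fin (2 * m + 1) × Fin r) : HolAt (fun z => u z p) y :=
  Quasioper.holAt_of_mulVec_eq (M := gramMatrix m B e)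
    (fun p q => hB y _ (h.mem _ (Nat.lt_succ_iff.1 p.1.2) p.2) _
    (h.mem _ (Nat.lt_succ_iff.1 q.1.2) q.2)) hc h.gram_det_ne_zero huc p

theorem exists_eq_sum_of_mem_derivedSpan {v : E y} (hv : v ∈ derivedSpan e (2 * m) y) :
    ∃ u : Fin (2 * m + 1) × Fin r → ℂ, v = ∑ q, u q • e q.1 q.2 y := by
  obtain ⟨u, hu⟩ := (Submodule.mem_span_range_iff_exists_fun ℂ).1 hv
  exact ⟨u, hu.symm⟩

/-- In the frame of `𝔽` and the Taylor coordinates of the jets, the map is the Gram matrix. Its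
invertibility gives bijectivity, and Cramer's rule gives holomorphy of the inverse. -/
theorem IsFlatJetMap.isHolIso {f : ∀ x, E x →ₗ[ℂ] _} (hm : 1 ≤ m)
    (h : IsQuasioper n m B Fil D) (hf : IsFlatJetMap D (Fil (2 * m)) (2 * m) f) :
    IsHolIso (subGerms F (subF m Fil D)) (jetGerms (quotGerms F (Fil (2 * m))) (2 * m))
      fun x => (f x).domRestrict (subF m Fil D x) := by
  refine ⟨fun x => ⟨?_, fun J => ?_⟩, fun x σ => ⟨fun hσ => hf.isHolHom x _ hσ, fun hσ => ?_⟩⟩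
  · rw [← LinearMap.ker_eq_bot, LinearMap.ker_eq_bot']
    rintro ⟨v, hv⟩ hfv
    obtain ⟨r, s, C, -, hs⟩ := hf.exists_gramFrame_jetCoord hm h x
    have hF := (eventually_subF_eq hm h (hs.mono fun y hy => hy.1)).self_of_nhds
    obtain ⟨hgram, -, hval⟩ := hs.self_of_nhds
    obtain ⟨u, rfl⟩ := exists_eq_sum_of_mem_derivedSpan (hF ▸ hv)
    have hfv' : f x (∑ q : Fin (2 * m + 1) × Fin r, u q • derivedFamily D x s q.1 q.2 x) = 0 := hfv
    have hu : u = 0 := hgram.eq_zero fun p => by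
      rw [← hval, hfv', map_zero]
    refine Subtype.ext ?_
    simp [hu]
  · obtain ⟨r, s, C, -, hs⟩ := hf.exists_gramFrame_jetCoord hm h x
    have hF := (eventually_subF_eq hm h (hs.mono fun y hy => hy.1)).self_of_nhds
    obtain ⟨hgram, hsep, hval⟩ := hs.self_of_nhds
    refine ⟨⟨∑ q : Fin (2 * m + 1) × Fin r,
      (gramMatrix m B (derivedFamily D x s) x)⁻¹.mulVec (fun p => C x p J) q •
        derivedFamily D x s q.1 q.2 x, ?_⟩, sub_eq_zero.1 (hsep _ fun p => ?_)⟩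
    · rw [hF]
      exact Submodule.sum_mem _ fun q _ => Submodule.smul_mem _ _
        (mem_derivedSpan _ (Nat.lt_succ_iff.1 q.1.2) q.2 x)
    · rw [map_sub, LinearMap.domRestrict_apply, hval, form_sum, hgram.mulVec_inv, sub_self]
  · obtain ⟨r, s, C, hC, hs⟩ := hf.exists_gramFrame_jetCoord hm h x
    have hF := eventually_subF_eq hm h (hs.mono fun y hy => hy.1)
    have hu : ∀ y, ∃ u : Fin (2 * m + 1) × Fin r → ℂ,
        (σ y : E y) ∈ derivedSpan (derivedFamily D x s) (2 * m) y →
          (σ y : E y) = ∑ q, u q • derivedFamily D x s q.1 q.2 y := fun y => by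
      by_cases hy : (σ y : E y) ∈ derivedSpan (derivedFamily D x s) (2 * m) y
      · obtain ⟨u, hu⟩ := exists_eq_sum_of_mem_derivedSpan hy
        exact ⟨u, fun _ => hu⟩
      · exact ⟨0, fun hy' => absurd hy' hy⟩
    choose u hu using hu
    have hσu : ∀ᶠ y in 𝓝 x, (σ y : E y) = ∑ q, u y q • derivedFamily D x s q.1 q.2 y :=
      hF.mono fun y hy => hu y (hy ▸ (σ y).2)
    have hgram := hs.self_of_nhds.1
    refine holGerms_congr (sum_smul_mem_holGerms (g := fun q y => u y q) (fun q _ =>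
      hgram.holAt_of_mulVec_eq h.bundle.holomorphic (hC _ hσ) ?_ q) fun q _ =>
        hgram.mem _ (Nat.lt_succ_iff.1 q.1.2) q.2) hσu
    filter_upwards [hs, hσu] with y hy hy'
    ext p
    rw [← form_sum, ← hy', LinearMap.domRestrict_apply, hy.2.2]

theorem IsFlatJetMap.ker_eq_subS {f : ∀ x, E x →ₗ[ℂ] _} (hm : 1 ≤ m)
    (h : IsQuasioper n m B Fil D) (hf : IsFlatJetMap D (Fil (2 * m)) (2 * m) f) (x : X) :
    LinearMap.ker (f x) = subS m Fil D x := by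
  obtain ⟨r, s, C, -, hs⟩ := hf.exists_gramFrame_jetCoord hm h x
  have hS := (eventually_mem_subS_iff hm h (hs.mono fun y hy => hy.1)).self_of_nhds
  obtain ⟨-, hsep, hval⟩ := hs.self_of_nhds
  ext v
  rw [hS v, LinearMap.mem_ker]
  constructor
  · intro hv p
    rw [← hval, hv, map_zero]
  · intro hv
    exact hsep _ fun p => by rw [hval, hv p]

/-- Nondegeneracy of the form on `𝔽` splits `E` as `𝔽` plus its orthogonal; projecting holomorphic
sections along `𝔽` gives a frame of the orthogonal. -/
theorem isHolSubbundle_subS (hm : 1 ≤ m) (h : IsQuasioper n m B Fil D) :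
    IsHolSubbundle F (subS m Fil D) := by
  refine isHolSubbundle_of_frames fun x => ?_
  have := finiteDimensional_fiber F (E := E) x
  have hB := h.bundle.holomorphic
  obtain ⟨r, s, -, hs⟩ := exists_gramFrame hm h x
  have hS := eventually_mem_subS_iff hm h hs
  have hgram := hs.self_of_nhds
  have hSx := hS.self_of_nhds
  set e := derivedFamily D x s
  let b := Module.finBasis ℂ (subS m Fil D x)
  have hb : ∀ k (p : Fin (2 * m + 1) × Fin r), B x (e p.1 p.2 x) (b k) = 0 :=
    fun k => (hSx _).1 (b k).2
  choose w hw hwx using fun k => exists_mem_holGerms F (b k : E x)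
  -- The coefficients of the projection of `w k` to `𝔽`; they vanish at `x`, where `w k` already
  -- lies in `𝒮`.
  let u k y := (gramMatrix m B e y)⁻¹.mulVec fun p => B y (e p.1 p.2 y) (w k y)
  have hu : ∀ k q, HolAt (fun y => u k y q) x := fun k =>
    hgram.holAt_of_mulVec_eq hB (fun p => hB x _ (hgram.mem _ (Nat.lt_succ_iff.1 p.1.2) p.2) _
      (hw k)) (hs.mono fun y hy => hy.mulVec_inv _)
  let t k y := w k y - ∑ q, u k y q • e q.1 q.2 y
  have ht : ∀ k, t k ∈ holGerms F x := fun k => by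
    have := sum_smul_mem_holGerms (t := Finset.univ) (g := fun q y => u k y q)
      (s := fun q : Fin (2 * m + 1) × Fin r => e q.1 q.2) (fun q _ => hu k q)
      fun q _ => hgram.mem _ (Nat.lt_succ_iff.1 q.1.2) q.2
    exact holGerms_congr ((holGerms F x).add_mem (hw k) ((holGerms F x).smul_mem (-1) this))
      (.of_forall fun y => by simp [t, sub_eq_add_neg])
  have htx : ∀ k, t k x = b k := fun k => by
    have : u k x = 0 := by
      have : (fun p : Fin (2 * m + 1) × Fin r => B x (e p.1 p.2 x) (w k x)) = 0 := by
        ext p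
        rw [hwx, hb, Pi.zero_apply]
      simp only [u, this, Matrix.mulVec_zero]
    simp [t, this, hwx]
  have htS : ∀ᶠ y in 𝓝 x, ∀ k (p : Fin (2 * m + 1) × Fin r), B y (e p.1 p.2 y) (t k y) = 0 :=
    hs.mono fun y hy k p => by rw [map_sub, form_sum, hy.mulVec_inv, sub_self]
  let a : (Fin (2 * m + 1) × Fin r) ⊕ Fin _ → Π y, E y :=
    Sum.elim (fun p => e p.1 p.2) t
  have ha : ∀ i, a i ∈ holGerms F x := by
    rintro (p | k)
    · exact hgram.mem _ (Nat.lt_succ_iff.1 p.1.2) p.2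
    · exact ht k
  have hbl : LinearIndependent ℂ fun k => (b k : E x) :=
    b.linearIndependent.map' (subS m Fil D x).subtype (Submodule.ker_subtype _)
  have hli : LinearIndependent ℂ fun i => a i x := by
    rw [Fintype.linearIndependent_iff]
    intro g hg
    rw [Fintype.sum_sum_type] at hg
    simp only [a, Sum.elim_inl, Sum.elim_inr, htx] at hg
    have h1 : (fun p => g (Sum.inl p)) = 0 := hgram.eq_zero fun p => by
      have h2 := congrArg (B x (e p.1 p.2 x)) hg
      rw [map_add, map_sum (B x (e p.1 p.2 x)) _ Finset.univ] at h2
      rw [map_sum]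
      simpa [hb] using h2
    have h2 : ∀ p, g (Sum.inl p) = 0 := congrFun h1
    simp only [h2, zero_smul, Finset.sum_const_zero, zero_add] at hg
    rintro (p | k)
    · exact h2 p
    · exact Fintype.linearIndependent_iff.1 hbl _ hg k
  have hspan : ⊤ ≤ Submodule.span ℂ (Set.range fun i => a i x) := fun v _ => by
    let c := (gramMatrix m B e x)⁻¹.mulVec fun p => B x (e p.1 p.2 x) v
    have hv : v - ∑ q, c q • e q.1 q.2 x ∈ subS m Fil D x := (hSx _).2 fun p => by
      rw [map_sub, form_sum, hgram.mulVec_inv, sub_self]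
    have hv' := congrArg Subtype.val (b.sum_repr ⟨_, hv⟩)
    rw [Submodule.coe_sum, Subtype.coe_mk] at hv'
    rw [← sub_add_cancel v (∑ q, c q • e q.1 q.2 x), ← hv']
    refine Submodule.add_mem _ (Submodule.sum_mem _ fun k _ => Submodule.smul_mem _ _ ?_)
      (Submodule.sum_mem _ fun q _ => Submodule.smul_mem _ _ ?_)
    · exact Submodule.subset_span ⟨Sum.inr k, htx k⟩
    · exact Submodule.subset_span ⟨Sum.inl q, rfl⟩
  refine ⟨_, inferInstance, t, ht, by simpa only [htx] using hbl, ?_⟩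
  filter_upwards [hs, hS, htS, eventually_span_eq_top (Module.Basis.mk hli hspan) ha fun i =>
    (Module.Basis.mk_apply hli hspan i).symm] with y hy hSy hty hay
  refine le_antisymm (fun v hv => ?_) (Submodule.span_le.2 ?_)
  · obtain ⟨g, hg⟩ := (Submodule.mem_span_range_iff_exists_fun ℂ).1
      (show v ∈ Submodule.span ℂ (Set.range fun i => a i y) by rw [hay.2]; trivial)
    rw [Fintype.sum_sum_type] at hg
    simp only [a, Sum.elim_inl, Sum.elim_inr] at hg
    -- Pairing with the Gram frame kills the `t` part and shows that a vector of `𝒮` has no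
    -- component along `𝔽`.
    have h1 : (fun p => g (Sum.inl p)) = 0 := hy.eq_zero fun p => by
      have h2 := (hSy v).1 hv p
      rw [← hg, map_add, map_sum (B y (e p.1 p.2 y)) _ Finset.univ] at h2
      rw [map_sum]
      simpa [hty] using h2
    have h2 : ∀ p, g (Sum.inl p) = 0 := congrFun h1
    simp only [h2, zero_smul, Finset.sum_const_zero, zero_add] at hg
    rw [← hg]
    exact Submodule.sum_mem _ fun k _ => Submodule.smul_mem _ _ (Submodule.subset_span ⟨k, rfl⟩)
  · rintro _ ⟨k, rfl⟩
    exact (hSy _).2 (hty k)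

end FlatJetMap

end Quasioper

end

theorem corollary3p3
    {X : Type*} [TopologicalSpace X] [T2Space X] [ConnectedSpace X]
    [ChartedSpace ℂ X] [IsManifold 𝓘(ℂ, ℂ) ω X]
    {F : Type*} [NormedAddCommGroup F] [NormedSpace ℂ F] [FiniteDimensional ℂ F]
    {E : X → Type*} [TopologicalSpace (TotalSpace F E)]
    [∀ x, AddCommGroup (E x)] [∀ x, Module ℂ (E x)] [∀ x, TopologicalSpace (E x)]
    [∀ x, IsTopologicalAddGroup (E x)] [∀ x, ContinuousSMul ℂ (E x)]
    [FiberBundle F E] [VectorBundle ℂ F E] [ContMDiffVectorBundle ω F E 𝓘(ℂ, ℂ)]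
    (n m : ℕ) (hn : 2 ≤ n) (hm : 2 ≤ m)
    (B : ∀ x, LinearMap.BilinForm ℂ (E x)) (Fil : ℕ → ∀ x, Submodule ℂ (E x))
    (D : CovariantDerivative 𝓘(ℂ, ℂ) F E) (h : Quasioper.IsQuasioper n m B Fil D) :
    ∃ f : ∀ x, E x →ₗ[ℂ] Quasioper.JetFiber (Quasioper.quotGerms F (Fil (2 * m))) (2 * m) x,
      -- `f` is the map produced by the flat sections of `D`, and it is holomorphic
      Quasioper.IsFlatJetMap D (Fil (2 * m)) (2 * m) f ∧
      Quasioper.IsHolHom (Quasioper.holGerms F)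
        (Quasioper.jetGerms (Quasioper.quotGerms F (Fil (2 * m))) (2 * m)) f ∧
      -- its restriction to the subbundle `𝔽` is an isomorphism onto the jet bundle
      Quasioper.IsHolSubbundle F (Quasioper.subF m Fil D) ∧
      Quasioper.IsHolIso (Quasioper.subGerms F (Quasioper.subF m Fil D))
        (Quasioper.jetGerms (Quasioper.quotGerms F (Fil (2 * m))) (2 * m))
        (fun x => (f x).domRestrict (Quasioper.subF m Fil D x)) ∧
      -- its kernel is the subbundle `𝒮`
      Quasioper.IsHolSubbundle F (Quasioper.subS m Fil D) ∧
      ∀ x, LinearMap.ker (f x) = Quasioper.subS m Fil D x := by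

  have hm' : 1 ≤ m := by omega
  obtain ⟨f, hf⟩ := Quasioper.exists_isFlatJetMap hm' h
  exact ⟨f, hf, hf.isHolHom, Quasioper.isHolSubbundle_subF hm' h, hf.isHolIso hm' h,
    Quasioper.isHolSubbundle_subS hm' h, hf.ker_eq_subS hm' h⟩
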